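/- Let $p>2$ be a prime and let $R$ be an integral domain of characteristic zero that is $p$-adically complete and separated (so $\bigcap_s p^sR=0$). Let $f\in R[x_1^{\pm1},\dots,x_n^{\pm1}]$ be a Laurent polynomial with Newton polytope $\Delta\subset\mathbb R^n$, and let $\mathbf b$ be a vertex of $\Delta$ such that the coefficient $f_{\mathbf b}$ of $\mathbf x^{\mathbf b}$ in $f$ is a unit in $R$. Let $\mu\subseteq\Delta$ be such that $\Delta\setminus\mu$ is a union of faces of $\Delta$ of any dimension (that is, $\mu$ is open in the topology on $\Delta$ whose closed sets are the unions of faces), and put $\mu_{\mathbb Z}=\mu\cap\mathbb Z^n$, $h=\#\mu_{\mathbb Z}$. Notation. Let $C(\mu)=\{\lambda(1,\mathbf u):\mathbf u\in\mu,\ \lambda\ge0\}\subset\mathbb R^{n+1}$ and $C(\Delta-\mathbf b)=\{\lambda(\mathbf u-\mathbf b):\mathbf u\in\Delta,\ \lambda\ge 0\}\subset\mathbb R^n$; a subscript $\mathbb Z$ denotes the set of integral points. For a non-zero integral point $\mathbf u=(u_0,u_1,\dots,u_n)$ of $C(\Delta)$ put $\omega_{\mathbf u}=(u_0-1)!\,x_1^{u_1}\cdots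 x_n^{u_n}/f^{u_0}$, and for $\mathbf u\in\Delta\cap\mathbb Z^n$ put $\omega_{\mathbf u}=\omega_{(1,\mathbf u)}=\mathbf x^{\mathbf u}/f$. These functions are expanded at $\mathbf b$ by writing $f=f_{\mathbf b}\mathbf x^{\mathbf b}(1+\ell)$ and expanding $(1+\ell)^{-u_0}$ as a binomial series; the result lies in the module $\Omega_{\rm formal}$ of formal series $\sum_{\mathbf k\in C(\Delta-\mathbf b)_{\mathbb Z}}a_{\mathbf k}\mathbf x^{\mathbf k}$ with $a_{\mathbf k}\in R$. Let $\Omega_f(\mu)$ be the $R$-span of the $\omega_{\mathbf u}$ with $\mathbf u$ a non-zero integral point of $C(\mu)$, let $\widehat\Omega_f(\mu)=\varprojlim_s\Omega_f(\mu)/p^s\Omega_f(\mu)$ be its $p$-adic completion, viewed inside $\Omega_{\rm formal}$ by formal expansion, let $d\Omega_{\rm formal}$ be the $R$-span of all $x_i\,\partial h/\partial x_i$ with $1\le i\le n$ and $h\in\Omega_{\rm formal}$, and let $U_f(\mu)=\widehat\Omega_f(\mu)\cap d\Omega_{\rm formal}$. Let $\mathscr C_p(\sum_{\mathbf k} a_{\mathbf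 k}\mathbf x^{\mathbf k})=\sum_{\mathbf k} a_{p\mathbf k}\mathbf x^{\mathbf k}$ be the Cartier operator. Derivations of $R$ act on series through the coefficients. For a ring endomorphism $\sigma$ of $R$, $f^\sigma$ is obtained by applying $\sigma$ to the coefficients of $f$; $\omega^\sigma_{\mathbf u}$ and $U_{f^\sigma}(\mu)$ are defined as above with $f^\sigma$ in place of $f$ and the same $\Delta$, $\mathbf b$, $\mu$. Assume that the Hasse--Witt matrix $\beta_p(\mu)$, the $h\times h$ matrix whose entry at $(\mathbf u,\mathbf v)\in\mu_{\mathbb Z}^2$ is the coefficient of $\mathbf x^{p\mathbf v-\mathbf u}$ in $f^{p-1}$, is invertible over $R$. For $\mathbf k\in C(\Delta-\mathbf b)_{\mathbb Z}$ let $\mathbf a_{\mathbf k}\in R^h$ be the column vector whose component at $\mathbf u\in\mu_{\mathbb Z}$ is the coefficient of $\mathbf x^{\mathbf k}$ in the formal expansion of $\omega_{\mathbf u}$. Then: (1) For every ring endomorphism $\sigma$ of $R$ with $\sigma(r)\equiv r^p\pmod p$ for all $r\in R$, there is a unique matrix $\Lambda_\sigma=(\lambda_{\mathbf u,\mathbf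 w})\in R^{h\times h}$ with $$\mathscr C_p(\omega_{\mathbf u})\equiv\sum_{\mathbf w\in\mu_{\mathbb Z}}\lambda_{\mathbf u,\mathbf w}\,\omega^\sigma_{\mathbf w}\pmod{U_{f^\sigma}(\mu)}\qquad\text{for all }\mathbf u\in\mu_{\mathbb Z},$$ and, for all $\mathbf k\in C(\Delta-\mathbf b)_{\mathbb Z}$ and all $s\ge1$, $$\mathbf a_{p^s\mathbf k}\equiv\Lambda_\sigma\,\mathbf a^\sigma_{p^{s-1}\mathbf k}\pmod{p^s},$$ where $\mathbf a^\sigma_{\mathbf k}$ is obtained by applying $\sigma$ to the components of $\mathbf a_{\mathbf k}$. (2) For every derivation $\delta$ of $R$ there is a unique matrix $N_\delta=(\nu_{\mathbf u,\mathbf w})\in R^{h\times h}$ with $$\delta(\omega_{\mathbf u})\equiv\sum_{\mathbf w\in\mu_{\mathbb Z}}\nu_{\mathbf u,\mathbf w}\,\omega_{\mathbf w}\pmod{U_f(\mu)}\qquad\text{for all }\mathbf u\in\mu_{\mathbb Z},$$ and, for all $\mathbf k\in C(\Delta-\mathbf b)_{\mathbb Z}$ and all $s\ge1$, $$\delta(\mathbf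 a_{p^s\mathbf k})\equiv N_\delta\,\mathbf a_{p^s\mathbf k}\pmod{p^s}.$$ -/

import Mathlib

namespace UnitRoot

noncomputable section

/-- Laurent polynomials in `n` variables over `R`: the group algebra of `ℤⁿ`.
The coefficient of `x^k` in `f` is `f.coeff k`. -/
abbrev Laurent (R : Type*) [CommRing R] (n : ℕ) : Type _ := AddMonoidAlgebra R (Fin n → ℤ)

/-- The `R`-module of all families of coefficients `∑ₖ aₖ x^k`, `k ∈ ℤⁿ`. -/
abbrev Series (R : Type*) (n : ℕ) : Type _ := (Fin n → ℤ) → R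

/-- An integral vector, seen in `ℝⁿ`. -/
def toReal {n : ℕ} (k : Fin n → ℤ) : Fin n → ℝ := fun i => (k i : ℝ)

/-- The Newton polytope: the convex hull in `ℝⁿ` of the support. -/
def newtonPolytope {R : Type*} [CommRing R] {n : ℕ} (f : Laurent R n) : Set (Fin n → ℝ) :=
  convexHull ℝ (toReal '' (f.coeff.support : Set (Fin n → ℤ)))

/-- `μ` is open in the finite topology on the polytope `Δ` whose closed sets are the unions of
faces of `Δ` of any dimension (`Δ` itself included). -/
def IsFaceOpen {n : ℕ} (Δ μ : Set (Fin n → ℝ)) : Prop :=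
  μ ⊆ Δ ∧ ∃ F : Set (Set (Fin n → ℝ)), (∀ φ ∈ F, IsExposed ℝ Δ φ) ∧ Δ \ μ = ⋃₀ F

theorem finite_lattice {R : Type*} [CommRing R] {n : ℕ} (f : Laurent R n) :
    {v : Fin n → ℤ | toReal v ∈ newtonPolytope f}.Finite := by
  have hb : Bornology.IsBounded (newtonPolytope f) :=
    isBounded_convexHull.2 ((f.coeff.support.finite_toSet.image toReal).isBounded)
  obtain ⟨C, hC⟩ := hb.exists_norm_le
  refine (Set.finite_Icc (fun _ : Fin n => -⌈C⌉) (fun _ => ⌈C⌉)).subset ?_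
  intro v hv
  have h : ∀ i, |(v i : ℝ)| ≤ C := fun i => (norm_le_pi_norm (toReal v) i).trans (hC _ hv)
  refine ⟨fun i => ?_, fun i => ?_⟩
  · have h1 := (abs_le.1 (h i)).1
    have h2 := Int.le_ceil C
    have h3 : ((-⌈C⌉ : ℤ) : ℝ) ≤ v i := by push_cast; linarith
    exact_mod_cast h3
  · have h1 := (abs_le.1 (h i)).2
    exact_mod_cast h1.trans (Int.le_ceil C)

open Classical in
/-- `μ_ℤ = μ ∩ ℤⁿ`, for a subset `μ` of the Newton polytope of `f`. -/
def latticePoints {R : Type*} [CommRing R] {n : ℕ} (f : Laurent R n) (μ : Set (Fin n → ℝ)) :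
    Finset (Fin n → ℤ) :=
  (finite_lattice f).toFinset.filter (fun v => toReal v ∈ μ)

/-- The cone `C(μ) ⊆ ℝ^{n+1}` spanned by `μ` placed in the hyperplane `u₀ = 1`. -/
def cone {n : ℕ} (μ : Set (Fin n → ℝ)) : Set (ℝ × (Fin n → ℝ)) :=
  {w | ∃ c : ℝ, 0 ≤ c ∧ ∃ x ∈ μ, w = c • ((1 : ℝ), x)}

/-- The non-zero integral points `(u₀, u₁, …, uₙ)` of `C(μ)`. (Points of the cone have `u₀ ≥ 0`,
so taking `u₀` in `ℕ` loses nothing; non-zero points have `u₀ ≥ 1`.) -/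
def coneLattice {n : ℕ} (μ : Set (Fin n → ℝ)) : Set (ℕ × (Fin n → ℤ)) :=
  {u | u ≠ 0 ∧ ((u.1 : ℝ), toReal u.2) ∈ cone μ}

/-- The cone `C(Δ - b) ⊆ ℝⁿ`. -/
def vertexCone {n : ℕ} (Δ : Set (Fin n → ℝ)) (b : Fin n → ℤ) : Set (Fin n → ℝ) :=
  {w | ∃ c : ℝ, 0 ≤ c ∧ ∃ x ∈ Δ, w = c • (x - toReal b)}

section Expansion

variable {R : Type*} [CommRing R] {n : ℕ}

/-- The Laurent polynomial `ℓ` in `f = f_b x^b (1 + ℓ)`, where the coefficient `f_b` is a unit. -/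
def tail (f : Laurent R n) (b : Fin n → ℤ) : Laurent R n :=
  AddMonoidAlgebra.single (-b) (Ring.inverse (f.coeff b)) * f - 1

/-- The formal expansion at the vertex `b` of the rational function `g / f^m`, that is
`g x^{-mb} f_b^{-m} (1 + ℓ)^{-m}` with
`(1 + ℓ)^{-m} = ∑ⱼ (-1)^j (m+j-1 choose j) ℓ^j`.
If `b` is a vertex of a polytope containing the support of `f`, only finitely many `j` contribute
to each coefficient. -/
def expansion (f : Laurent R n) (b : Fin n → ℤ) (g : Laurent R n) (m : ℕ) : Series R n :=
  fun k => Ring.inverse (f.coeff b) ^ m *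
    ∑ᶠ j : ℕ, (-1) ^ j * (Nat.multichoose m j : R) *
      (g * AddMonoidAlgebra.single (-(m • b)) 1 * tail f b ^ j).coeff k

/-- (The formal expansion at `b` of) `ω_u = (u₀ - 1)! x^u / f^{u₀}`. -/
def omega (f : Laurent R n) (b : Fin n → ℤ) (u : ℕ × (Fin n → ℤ)) : Series R n :=
  ((u.1 - 1).factorial : R) • expansion f b (AddMonoidAlgebra.single u.2 1) u.1

/-- The module `Ω_f(μ)`, embedded into formal series by expansion at `b`: the `R`-span of the
`ω_u` with `u` a non-zero integral point of `C(μ)`. -/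
def Omega (f : Laurent R n) (b : Fin n → ℤ) (μ : Set (Fin n → ℝ)) : Submodule R (Series R n) :=
  Submodule.span R (omega f b '' coneLattice μ)

/-- The `p`-adic completion of `Ω_f(μ)`, realized in formal series: the series that come from an
element of the inverse limit of `Ω_f(μ) / p^s Ω_f(μ)` under the map of completions induced by the
inclusion of `Ω_f(μ)` into the (`p`-adically complete) module of all series. -/
def OmegaHat (p : ℕ) (f : Laurent R n) (b : Fin n → ℤ) (μ : Set (Fin n → ℝ)) :
    Submodule R (Series R n) :=
  (LinearMap.range ((AdicCompletion.map (Ideal.span {(p : R)})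
    (Omega f b μ).subtype).restrictScalars R)).comap
      (AdicCompletion.of (Ideal.span {(p : R)}) (Series R n))

variable (R) in
/-- The module `Ω_formal` of formal Laurent series supported in `C(Δ - b)`. -/
def OmegaFormal (Δ : Set (Fin n → ℝ)) (b : Fin n → ℤ) : Submodule R (Series R n) where
  carrier := {h | ∀ k, toReal k ∉ vertexCone Δ b → h k = 0}
  add_mem' := fun ha hb k hk => by simp [ha k hk, hb k hk]
  zero_mem' := fun _ _ => rfl
  smul_mem' := fun c _ ha k hk => by simp [ha k hk]

/-- The derivation `x_i ∂/∂x_i` on series. -/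
def theta (i : Fin n) (h : Series R n) : Series R n := fun k => (k i : R) * h k

variable (R) in
/-- The module `dΩ_formal` of formal derivatives: the `R`-span of all `x_i ∂h/∂x_i` with
`h ∈ Ω_formal`. -/
def dOmegaFormal (Δ : Set (Fin n → ℝ)) (b : Fin n → ℤ) : Submodule R (Series R n) :=
  Submodule.span R {g | ∃ i : Fin n, ∃ h ∈ OmegaFormal R Δ b, g = theta i h}

/-- `U_f(μ)`: the elements of the completed module that are formal derivatives. -/
def formalExact (p : ℕ) (Δ : Set (Fin n → ℝ)) (f : Laurent R n) (b : Fin n → ℤ)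
    (μ : Set (Fin n → ℝ)) : Submodule R (Series R n) :=
  OmegaHat p f b μ ⊓ dOmegaFormal R Δ b

/-- The Cartier operator `∑ aₖ x^k ↦ ∑ a_{pk} x^k`. -/
def cartier (p : ℕ) (h : Series R n) : Series R n := fun k => h (p • k)

/-- A derivation of `R` acts on series through the coefficients. -/
def derivSeries (δ : Derivation ℤ R R) (h : Series R n) : Series R n := fun k => δ (h k)

/-- `f^σ`: the ring endomorphism `σ` applied to the coefficients of `f`. -/
def twist (σ : R →+* R) (f : Laurent R n) : Laurent R n :=
  AddMonoidAlgebra.mapRingHom (Fin n → ℤ) σ f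

/-- A lift of the `p`-th power Frobenius. -/
def IsFrobeniusLift (p : ℕ) (σ : R →+* R) : Prop := ∀ r : R, (p : R) ∣ σ r - r ^ p

/-- The matrix `β_m(μ)`: its `(u, v)` entry is the coefficient of `x^{mv-u}` in `f^{m-1}`.
`β_p(μ)` is the Hasse--Witt matrix of `f` relative to `μ`. -/
def beta (f : Laurent R n) (μ : Set (Fin n → ℝ)) (m : ℕ) :
    Matrix (latticePoints f μ) (latticePoints f μ) R :=
  fun u v => (f ^ (m - 1)).coeff (m • (v : Fin n → ℤ) - (u : Fin n → ℤ))

/-- `Λ` is the (transposed) matrix of the Cartier operator `Q_f(μ) → Q_{f^σ}(μ)` in the bases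
`ω_u`, `ω_u^σ`: for all `u ∈ μ_ℤ`, the Cartier operator maps `ω_u` to `∑_w λ_{u,w} ω_w^σ` modulo
`U_{f^σ}(μ)`. -/
def IsCartierMatrix (p : ℕ) (f : Laurent R n) (b : Fin n → ℤ) (μ : Set (Fin n → ℝ))
    (σ : R →+* R) (Λ : Matrix (latticePoints f μ) (latticePoints f μ) R) : Prop :=
  ∀ u : latticePoints f μ,
    cartier p (omega f b (1, (u : Fin n → ℤ))) -
        ∑ w : latticePoints f μ, Λ u w • omega (twist σ f) b (1, (w : Fin n → ℤ)) ∈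
      formalExact p (newtonPolytope f) (twist σ f) b μ

/-- `N` is the (transposed) matrix of the connection `δ` on `Q_f(μ)` in the basis `ω_u`:
for all `u ∈ μ_ℤ`, `δ(ω_u)` is `∑_w ν_{u,w} ω_w` modulo `U_f(μ)`. -/
def IsConnectionMatrix (p : ℕ) (f : Laurent R n) (b : Fin n → ℤ) (μ : Set (Fin n → ℝ))
    (δ : Derivation ℤ R R) (N : Matrix (latticePoints f μ) (latticePoints f μ) R) : Prop :=
  ∀ u : latticePoints f μ,
    derivSeries δ (omega f b (1, (u : Fin n → ℤ))) -
        ∑ w : latticePoints f μ, N u w • omega f b (1, (w : Fin n → ℤ)) ∈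
      formalExact p (newtonPolytope f) f b μ

/-- The column vector `a_k`: its `u`-th component, `u ∈ μ_ℤ`, is the coefficient of `x^k` in the
formal expansion of `ω_u = x^u / f` at `b`. -/
def coeffVector (f : Laurent R n) (b : Fin n → ℤ) (μ : Set (Fin n → ℝ)) (k : Fin n → ℤ) :
    latticePoints f μ → R :=
  fun u => omega f b (1, (u : Fin n → ℤ)) k

end Expansion

end

end UnitRoot

open UnitRoot

/-! The core is a decomposition: modulo formal derivatives, the completion of `Omega f b μ` is free
on the ω_u with u in μ_ℤ (`IsVertexWeight.exists_decomposition`,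
`IsVertexWeight.eq_zero_of_omegaSum_mem`). Part (2) applies it to δ(ω_u) = -x^u δ(f)/f². Part (1)
applies it to η in C_p(ω_u) = (combination of the ω_v^σ) + pη; the extra factor p there is what
makes the congruence at p^s k hold modulo p^s although the right side involves p^{s-1} k.

A series supported in the cone is a formal derivative exactly when p^s divides its coefficient at
p^s k for all s and k (`pow_dvd_of_mem_dOmegaFormal`, `mem_dOmegaFormal`), that is, when p^s divides
its image under C_p^s. So the Cartier operator has to be understood p-adically. If the coefficients
of f' are congruent mod p to the p-th powers of those of f, then f^p = f'(x^p) - pG, and expanding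
in powers of pG gives C_p(A/f^{pM}) = Σ_r p^r multichoose(M, r) C_p(A G^r)/f'^{M+r}
(`IsVertexWeight.cartier_expansion`). After normalising by the factorials in the ω_u, the r-th term
carries p^r/r!, which for p > 2 and r ≥ 1 is divisible by p and tends to 0. Hence modulo p only r =
0 survives: C_p sends everything into the span of the ω_v with v in μ_ℤ, and acts on this span by
the Hasse–Witt matrix (`IsVertexWeight.cartier_omega`, `IsVertexWeight.cartier_mem_of_mem_Omega`).

Invertibility of that matrix passes from f to f'. Given x, the coefficients c are therefore found
one p-adic digit at a time so that p^s divides C_p^s(x - Σ c_u ω_u) for every s; the same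
invertibility forces c = 0 when Σ c_u ω_u is already a formal derivative. The iterates of C_p run
along a chain of twists of f; raising coefficients to the power p supplies such a chain without any
Frobenius lift.

Identities between expansions are checked after multiplying by a power of f, since division by f is
unique and preserves divisibility on series bounded below (`IsVertexWeight.dvd_of_dvd_act`). -/

namespace UnitRoot

/-! ### Convex geometry: dilations, cones, and a weight singling out the vertex. -/

section Geometry

variable {n : ℕ} {Δ μ : Set (Fin n → ℝ)} {b : Fin n → ℤ}

theorem toReal_zero : toReal (0 : Fin n → ℤ) = 0 := by ext; simp [toReal]

theorem toReal_add (k l : Fin n → ℤ) : toReal (k + l) = toReal k + toReal l := by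
  ext; simp [toReal]

theorem toReal_neg (k : Fin n → ℤ) : toReal (-k) = -toReal k := by
  ext; simp [toReal]

theorem toReal_nsmul (m : ℕ) (k : Fin n → ℤ) : toReal (m • k) = (m : ℝ) • toReal k := by
  ext; simp [toReal]

theorem toReal_injective : Function.Injective (toReal (n := n)) := by
  intro k l h
  ext i
  simpa [toReal] using congrFun h i

/-- The integral points of the dilation `m μ`. -/
def dilation (μ : Set (Fin n → ℝ)) (m : ℕ) : Set (Fin n → ℤ) :=
  {v | ∃ x ∈ μ, toReal v = (m : ℝ) • x}

theorem mem_dilation_one {v : Fin n → ℤ} : v ∈ dilation μ 1 ↔ toReal v ∈ μ := by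
  simp [dilation]

theorem dilation_mono {μ ν : Set (Fin n → ℝ)} (h : μ ⊆ ν) (m : ℕ) :
    dilation μ m ⊆ dilation ν m := fun _ ⟨x, hx, hv⟩ => ⟨x, h hx, hv⟩

theorem mem_coneLattice {u : ℕ × (Fin n → ℤ)} :
    u ∈ coneLattice μ ↔ 1 ≤ u.1 ∧ u.2 ∈ dilation μ u.1 := by
  constructor
  · rintro ⟨h0, c, -, x, hx, h⟩
    rw [Prod.ext_iff] at h
    simp only [Prod.smul_mk, smul_eq_mul, mul_one] at h
    obtain ⟨h1, h2⟩ := h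
    refine ⟨?_, x, hx, by rw [h1]; exact h2⟩
    by_contra hlt
    have h3 : u.1 = 0 := by omega
    apply h0
    refine Prod.ext h3 (toReal_injective ?_)
    rw [h2, ← h1, h3]
    simp [toReal_zero]
  · rintro ⟨h1, x, hx, h⟩
    refine ⟨fun h0 => by simp [h0] at h1, u.1, by positivity, x, hx, ?_⟩
    rw [h]
    simp

/-- Faces are extreme: a face containing an interior point of the segment would contain the endpoint
x as well. -/
theorem IsFaceOpen.combo_mem (hμ : IsFaceOpen Δ μ) (hΔ : Convex ℝ Δ) {x y : Fin n → ℝ}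
    (hx : x ∈ μ) (hy : y ∈ Δ) {s t : ℝ} (hs : 0 < s) (ht : 0 ≤ t) (hst : s + t = 1) :
    s • x + t • y ∈ μ := by
  obtain ⟨hsub, F, hF, hd⟩ := hμ
  rcases ht.eq_or_lt with rfl | ht
  · obtain rfl : s = 1 := by linarith
    simpa using hx
  by_contra hn
  have hz : s • x + t • y ∈ Δ := hΔ (hsub hx) hy hs.le ht.le hst
  have hz' : s • x + t • y ∈ Δ \ μ := ⟨hz, hn⟩
  rw [hd] at hz'
  obtain ⟨φ, hφ, hzφ⟩ := hz'
  have hxφ : x ∈ φ := (hF φ hφ).isExtreme.left_mem_of_mem_openSegment (hsub hx) hy hzφ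
    ⟨s, t, hs, ht, hst, rfl⟩
  have : x ∈ Δ \ μ := by rw [hd]; exact ⟨φ, hφ, hxφ⟩
  exact this.2 hx

theorem isFaceOpen_self (Δ : Set (Fin n → ℝ)) : IsFaceOpen Δ Δ :=
  ⟨subset_rfl, ∅, by simp, by simp⟩

/-- This is what keeps numerators over μ when they are multiplied by f or by the remainder G. It
needs m ≥ 1, so that the point of μ has positive weight in the convex combination. -/
theorem IsFaceOpen.dilation_add (hμ : IsFaceOpen Δ μ) (hΔ : Convex ℝ Δ) {m r : ℕ} (hm : 1 ≤ m)
    {v v' : Fin n → ℤ} (hv : v ∈ dilation μ m) (hv' : v' ∈ dilation Δ r) :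
    v + v' ∈ dilation μ (m + r) := by
  obtain ⟨x, hx, hvx⟩ := hv
  obtain ⟨y, hy, hvy⟩ := hv'
  have hm' : (0 : ℝ) < m := by exact_mod_cast hm
  have hmr : (0 : ℝ) < m + r := by positivity
  refine ⟨((m : ℝ) / (m + r)) • x + ((r : ℝ) / (m + r)) • y,
    hμ.combo_mem hΔ hx hy (by positivity) (by positivity) (by field_simp), ?_⟩
  rw [toReal_add, hvx, hvy, smul_add, smul_smul, smul_smul]
  push_cast
  congr 2 <;> field_simp

theorem dilation_of_nsmul {p m : ℕ} (hp : p ≠ 0) {v : Fin n → ℤ}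
    (hv : p • v ∈ dilation μ (p * m)) : v ∈ dilation μ m := by
  obtain ⟨x, hx, h⟩ := hv
  refine ⟨x, hx, ?_⟩
  rw [toReal_nsmul, Nat.cast_mul, mul_smul] at h
  exact smul_right_injective _ (Nat.cast_ne_zero.2 hp) h

theorem nsmul_mem_dilation {p m : ℕ} {v : Fin n → ℤ} (hv : v ∈ dilation μ m) :
    p • v ∈ dilation μ (p * m) := by
  obtain ⟨x, hx, h⟩ := hv
  exact ⟨x, hx, by rw [toReal_nsmul, h, Nat.cast_mul, mul_smul]⟩

theorem vertexCone_add (hΔ : Convex ℝ Δ) {x y : Fin n → ℝ} (hx : x ∈ vertexCone Δ b)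
    (hy : y ∈ vertexCone Δ b) : x + y ∈ vertexCone Δ b := by
  obtain ⟨c, hc, x', hx', rfl⟩ := hx
  obtain ⟨d, hd, y', hy', rfl⟩ := hy
  rcases (add_nonneg hc hd).eq_or_lt with h | h
  · obtain rfl : c = 0 := by linarith
    obtain rfl : d = 0 := by linarith
    exact ⟨0, le_rfl, x', hx', by simp⟩
  · refine ⟨c + d, h.le, (c / (c + d)) • x' + (d / (c + d)) • y',
      hΔ hx' hy' (by positivity) (by positivity) (by field_simp), ?_⟩
    ext i
    simp only [Pi.add_apply, Pi.smul_apply, Pi.sub_apply, smul_eq_mul]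
    field_simp
    ring

theorem vertexCone_zero (h : Δ.Nonempty) : 0 ∈ vertexCone Δ b := by
  obtain ⟨x, hx⟩ := h
  exact ⟨0, le_rfl, x, hx, by simp⟩

theorem vertexCone_of_nsmul {p : ℕ} (hp : 0 < p) {k : Fin n → ℤ}
    (h : toReal (p • k) ∈ vertexCone Δ b) : toReal k ∈ vertexCone Δ b := by
  obtain ⟨c, hc, x, hx, h⟩ := h
  have hp' : (0 : ℝ) < p := by exact_mod_cast hp
  refine ⟨c / p, by positivity, x, hx, ?_⟩
  rw [toReal_nsmul] at h
  rw [div_eq_inv_mul, mul_smul, ← h, inv_smul_smul₀ hp'.ne']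

theorem dilation_sub_mem_vertexCone {m : ℕ} {v : Fin n → ℤ} (hv : v ∈ dilation Δ m) :
    toReal (v + -(m • b)) ∈ vertexCone Δ b := by
  obtain ⟨x, hx, h⟩ := hv
  refine ⟨m, by positivity, x, hx, ?_⟩
  rw [toReal_add, toReal_neg, toReal_nsmul, h, smul_sub, sub_eq_add_neg]

/-- An additive weight on `ℤⁿ` which exhibits `b` as a vertex of `Δ`. -/
structure IsVertexWeight (Δ : Set (Fin n → ℝ)) (b : Fin n → ℤ) (w : (Fin n → ℤ) →+ ℝ) (ε : ℝ) :
    Prop where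
  convex : Convex ℝ Δ
  mem : toReal b ∈ Δ
  pos : 0 < ε
  gap : ∀ v : Fin n → ℤ, toReal v ∈ Δ → v ≠ b → w b + ε ≤ w v
  nonneg : ∀ k : Fin n → ℤ, toReal k ∈ vertexCone Δ b → 0 ≤ w k

/-- Hahn–Banach separates the extreme point b from the hull of the finitely many other lattice
points. Using all lattice points of Δ, not only the support of f, makes one weight serve every twist
of f. -/
theorem exists_isVertexWeight {R : Type*} [CommRing R] (f : Laurent R n)
    (hb : toReal b ∈ (newtonPolytope f).extremePoints ℝ) :
    ∃ w ε, IsVertexWeight (newtonPolytope f) b w ε := by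
  set Δ := newtonPolytope f with hΔ
  have hconv : Convex ℝ Δ := convex_convexHull ℝ _
  set S : Set (Fin n → ℝ) := toReal '' {v : Fin n → ℤ | toReal v ∈ Δ} \ {toReal b} with hS
  have hfin : S.Finite := ((finite_lattice f).image _).subset Set.sdiff_subset
  have hbS : toReal b ∉ convexHull ℝ S := by
    have h := ((hconv.mem_extremePoints_iff_mem_sdiff_convexHull_sdiff).1 hb).2
    refine fun h' => h (convexHull_mono ?_ h')
    rintro x ⟨⟨v, hv, rfl⟩, hx⟩
    exact ⟨hv, hx⟩
  obtain ⟨L, u, hu, hL⟩ := geometric_hahn_banach_point_closed (convex_convexHull ℝ S)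
    (hfin.isClosed_convexHull ℝ) hbS
  have hgap : ∀ v : Fin n → ℤ, toReal v ∈ Δ → v ≠ b → L (toReal b) + (u - L (toReal b)) ≤
      L (toReal v) := by
    intro v hv hvb
    have := hL (toReal v) (subset_convexHull ℝ S
      ⟨⟨v, hv, rfl⟩, fun h => hvb (toReal_injective h)⟩)
    linarith
  have hge : ∀ x ∈ Δ, L (toReal b) ≤ L x := by
    intro x hx
    have hsub : Δ ⊆ {x | L (toReal b) ≤ L x} := by
      refine convexHull_min ?_ (convex_halfSpace_ge L.toLinearMap.isLinear _)
      rintro _ ⟨v, hv, rfl⟩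
      by_cases hvb : v = b
      · simp [hvb]
      · have := hgap v (subset_convexHull ℝ _ ⟨v, hv, rfl⟩) hvb
        simp only [Set.mem_ofPred_eq]
        linarith
    exact hsub hx
  refine ⟨{ toFun := fun k => L (toReal k)
            map_zero' := by simp [toReal_zero]
            map_add' := fun k l => by simp [toReal_add] }, u - L (toReal b), hconv,
          extremePoints_subset hb, by linarith, hgap, ?_⟩
  rintro k ⟨c, hc, x, hx, hk⟩
  have := hge x hx
  simp only [AddMonoidHom.coe_mk, ZeroHom.coe_mk, hk, map_smul, map_sub, smul_eq_mul]
  exact mul_nonneg hc (by linarith)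

end Geometry

/-! ### Supports of Laurent polynomials. -/

section Support

variable {R : Type*} [CommRing R] {n : ℕ}

/-- The support of the Laurent polynomial `g` is contained in `A`. -/
def SuppIn (g : Laurent R n) (A : Set (Fin n → ℤ)) : Prop := ∀ k, g.coeff k ≠ 0 → k ∈ A

variable {g q : Laurent R n} {A B C : Set (Fin n → ℤ)}

theorem SuppIn.mono (hg : SuppIn g A) (h : A ⊆ B) : SuppIn g B := fun k hk => h (hg k hk)

theorem SuppIn.eq_zero (hg : SuppIn g A) {k : Fin n → ℤ} (hk : k ∉ A) : g.coeff k = 0 :=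
  by_contra fun h => hk (hg k h)

theorem suppIn_single {v : Fin n → ℤ} {r : R} (h : v ∈ A) :
    SuppIn (AddMonoidAlgebra.single v r) A := by
  classical
  intro k hk
  rw [AddMonoidAlgebra.coeff_single, Finsupp.single_apply] at hk
  split_ifs at hk with h1
  · exact h1 ▸ h
  · exact absurd rfl hk

theorem SuppIn.add (hg : SuppIn g A) (hq : SuppIn q A) : SuppIn (g + q) A := by
  intro k hk
  by_contra h
  simp [hg.eq_zero h, hq.eq_zero h] at hk

theorem SuppIn.sub (hg : SuppIn g A) (hq : SuppIn q A) : SuppIn (g - q) A := by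
  intro k hk
  by_contra h
  simp [hg.eq_zero h, hq.eq_zero h] at hk

theorem SuppIn.mul (hg : SuppIn g A) (hq : SuppIn q B) (h : ∀ x ∈ A, ∀ y ∈ B, x + y ∈ C) :
    SuppIn (g * q) C := by
  classical
  intro k hk
  have := AddMonoidAlgebra.support_coeff_mul_subset g q (Finsupp.mem_support_iff.2 hk)
  obtain ⟨x, hx, y, hy, rfl⟩ := Finset.mem_add.1 this
  exact h x (hg x (Finsupp.mem_support_iff.1 hx)) y (hq y (Finsupp.mem_support_iff.1 hy))

theorem suppIn_one (h : (0 : Fin n → ℤ) ∈ A) : SuppIn (1 : Laurent R n) A := suppIn_single h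

theorem SuppIn.pow_of_add_mem (hg : SuppIn g A) (h0 : (0 : Fin n → ℤ) ∈ A)
    (h : ∀ x ∈ A, ∀ y ∈ A, x + y ∈ A) (m : ℕ) : SuppIn (g ^ m) A := by
  induction m with
  | zero => rw [pow_zero]; exact suppIn_one h0
  | succ m ih => rw [pow_succ]; exact ih.mul hg h

theorem SuppIn.pow_dilation {Δ : Set (Fin n → ℝ)} (hΔ : Convex ℝ Δ) (hne : Δ.Nonempty) {a : ℕ}
    (ha : 1 ≤ a) (hg : SuppIn g (dilation Δ a)) (m : ℕ) : SuppIn (g ^ m) (dilation Δ (a * m)) := by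
  induction m with
  | zero =>
    obtain ⟨x, hx⟩ := hne
    rw [pow_zero]
    exact suppIn_one ⟨x, hx, by simp [toReal_zero]⟩
  | succ m ih =>
    rw [pow_succ', mul_add, mul_one, add_comm]
    exact hg.mul ih fun x hx y hy => (isFaceOpen_self Δ).dilation_add hΔ ha hx hy

theorem SuppIn.mul_dilation {Δ μ : Set (Fin n → ℝ)} (hμ : IsFaceOpen Δ μ) (hΔ : Convex ℝ Δ)
    {m r : ℕ} (hm : 1 ≤ m) (hg : SuppIn g (dilation μ m)) (hq : SuppIn q (dilation Δ r)) :
    SuppIn (g * q) (dilation μ (m + r)) :=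
  hg.mul hq fun _ hx _ hy => hμ.dilation_add hΔ hm hx hy

theorem suppIn_newtonPolytope (f : Laurent R n) : SuppIn f (dilation (newtonPolytope f) 1) :=
  fun k hk => mem_dilation_one.2
    (subset_convexHull ℝ _ ⟨k, Finsupp.mem_support_iff.2 hk, rfl⟩)

end Support

noncomputable section

open AddMonoidAlgebra Filter

/-! ### Series as a module over Laurent polynomials; division by f. -/

section Action

variable {R : Type*} [CommRing R] {n : ℕ}

/-- Multiplication of a series by the monomial `x^j`. -/
def shift (R : Type*) [CommRing R] {n : ℕ} (j : Fin n → ℤ) : Module.End R (Series R n) where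
  toFun h k := h (k - j)
  map_add' _ _ := rfl
  map_smul' _ _ := rfl

/-- The multiplication of series by Laurent polynomials. -/
def act : Laurent R n →ₐ[R] Module.End R (Series R n) :=
  AddMonoidAlgebra.lift R (Module.End R (Series R n)) (Fin n → ℤ)
    { toFun := fun j => shift R j.toAdd
      map_one' := by
        ext h k
        simp [shift]
      map_mul' := fun i j => by
        ext h k
        simp [shift, sub_sub] }

theorem act_single (j : Fin n → ℤ) (a : R) (h : Series R n) (k : Fin n → ℤ) :
    act (single j a) h k = a * h (k - j) := by
  simp [act, shift]

theorem act_apply (g : Laurent R n) (h : Series R n) (k : Fin n → ℤ) :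
    act g h k = ∑ j ∈ g.coeff.support, g.coeff j * h (k - j) := by
  rw [act, AddMonoidAlgebra.lift_apply, Finsupp.sum, LinearMap.sum_apply, Finset.sum_apply]
  rfl

theorem act_mul (g q : Laurent R n) (h : Series R n) : act (g * q) h = act g (act q h) := by
  rw [map_mul]; rfl

theorem act_add (g q : Laurent R n) (h : Series R n) : act (g + q) h = act g h + act q h := by
  rw [map_add]; rfl

/-- A Laurent polynomial as a series. -/
def toSeries : Laurent R n →ₗ[R] Series R n where
  toFun g := g.coeff
  map_add' _ _ := rfl
  map_smul' _ _ := rfl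

theorem toSeries_apply (g : Laurent R n) (k : Fin n → ℤ) : toSeries g k = g.coeff k := rfl

theorem coeff_single_mul' (j : Fin n → ℤ) (a : R) (g : Laurent R n) (k : Fin n → ℤ) :
    (single j a * g).coeff k = a * g.coeff (k - j) :=
  AddMonoidAlgebra.coeff_single_mul_eq_mul_coeff (k - j) fun d _ => by
    rw [eq_sub_iff_add_eq, add_comm]

theorem act_toSeries (g q : Laurent R n) : act g (toSeries q) = toSeries (g * q) := by
  induction g using AddMonoidAlgebra.induction_linear with
  | zero => simp
  | add x y hx hy => rw [act_add, hx, hy, add_mul, map_add]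
  | single j a =>
    ext k
    rw [act_single, toSeries_apply, toSeries_apply, coeff_single_mul']

/-- Series with support bounded below for the weight `w`. -/
def bddSeries (R : Type*) [CommRing R] {n : ℕ} (w : (Fin n → ℤ) →+ ℝ) :
    Submodule R (Series R n) where
  carrier := {h | ∃ c : ℝ, ∀ k, w k < c → h k = 0}
  add_mem' := by
    rintro x y ⟨c, hc⟩ ⟨d, hd⟩
    refine ⟨min c d, fun k hk => ?_⟩
    rw [Pi.add_apply, hc k (hk.trans_le (min_le_left _ _)), hd k (hk.trans_le (min_le_right _ _)),
      add_zero]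
  zero_mem' := ⟨0, fun _ _ => rfl⟩
  smul_mem' := by
    rintro a x ⟨c, hc⟩
    exact ⟨c, fun k hk => by rw [Pi.smul_apply, hc k hk, smul_zero]⟩

theorem act_mem_bddSeries (w : (Fin n → ℤ) →+ ℝ) (g : Laurent R n) {h : Series R n}
    (hh : h ∈ bddSeries R w) : act g h ∈ bddSeries R w := by
  induction g using AddMonoidAlgebra.induction_linear with
  | zero => simp
  | add x y hx hy => rw [act_add]; exact Submodule.add_mem _ hx hy
  | single j a =>
    obtain ⟨c, hc⟩ := hh
    refine ⟨c + w j, fun k hk => ?_⟩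
    rw [act_single, hc _ (by rw [map_sub]; linarith), mul_zero]

variable {Δ : Set (Fin n → ℝ)} {b : Fin n → ℤ} {w : (Fin n → ℤ) →+ ℝ} {ε : ℝ}

theorem IsVertexWeight.omegaFormal_le (hw : IsVertexWeight Δ b w ε) :
    OmegaFormal R Δ b ≤ bddSeries R w := fun _ hh =>
  ⟨0, fun k hk => hh k fun hk' => absurd (hw.nonneg k hk') (not_le.2 hk)⟩

/-- Division by `f` preserves divisibility of series. -/
theorem IsVertexWeight.dvd_of_dvd_act (hw : IsVertexWeight Δ b w ε) {f : Laurent R n}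
    (hf : SuppIn f (dilation Δ 1)) (hfb : IsUnit (f.coeff b)) {d : R} {h : Series R n}
    (hh : h ∈ bddSeries R w) (hd : ∀ k, d ∣ act f h k) (k : Fin n → ℤ) : d ∣ h k := by
  classical
  by_contra hk
  -- Descent: the coefficient of f h at k + b is f_b h_k plus terms h_{k+b-j} of weight at most w k
  -- - ε. If d divided all of these it would divide h_k; repeating the step leaves the region where
  -- h can be non-zero.
  have step : ∀ k, ¬ d ∣ h k → ∃ k', ¬ d ∣ h k' ∧ w k' ≤ w k - ε := by
    intro k hk
    by_contra! hcon
    apply hk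
    have hb : b ∈ f.coeff.support ∨ f.coeff b = 0 := by
      by_cases h0 : f.coeff b = 0
      · exact Or.inr h0
      · exact Or.inl (Finsupp.mem_support_iff.2 h0)
    have h1 := hd (k + b)
    rw [act_apply] at h1
    have h2 : ∀ j ∈ f.coeff.support.erase b, d ∣ f.coeff j * h (k + b - j) := by
      intro j hj
      obtain ⟨hjb, hj⟩ := Finset.mem_erase.1 hj
      refine Dvd.dvd.mul_left ?_ _
      by_contra h3
      have h4 := hcon _ h3
      have h5 := hw.gap j (mem_dilation_one.1 (hf j (Finsupp.mem_support_iff.1 hj))) hjb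
      rw [map_sub, map_add] at h4
      linarith
    have h6 : d ∣ f.coeff b * h k := by
      rcases hb with hb | hb
      · rw [← Finset.add_sum_erase _ _ hb, add_sub_cancel_right] at h1
        exact (dvd_add_left (Finset.dvd_sum h2)).1 h1
      · simp [hb]
    exact (hfb.dvd_mul_left).1 h6
  have many : ∀ N : ℕ, ∃ k', ¬ d ∣ h k' ∧ w k' ≤ w k - N * ε := by
    intro N
    induction N with
    | zero => exact ⟨k, hk, by simp⟩
    | succ N ih =>
      obtain ⟨k1, hk1, h1⟩ := ih
      obtain ⟨k2, hk2, h2⟩ := step k1 hk1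
      refine ⟨k2, hk2, ?_⟩
      push_cast
      linarith
  obtain ⟨c, hc⟩ := hh
  obtain ⟨N, hN⟩ := exists_nat_gt ((w k - c) / ε)
  rw [div_lt_iff₀ hw.pos] at hN
  obtain ⟨k', hk', h'⟩ := many N
  exact hk' (by rw [hc k' (by linarith)]; exact dvd_zero d)

theorem IsVertexWeight.dvd_of_dvd_act_pow (hw : IsVertexWeight Δ b w ε) {f : Laurent R n}
    (hf : SuppIn f (dilation Δ 1)) (hfb : IsUnit (f.coeff b)) {d : R} {h : Series R n}
    (hh : h ∈ bddSeries R w) (m : ℕ) (hd : ∀ k, d ∣ act (f ^ m) h k) (k : Fin n → ℤ) :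
    d ∣ h k := by
  induction m generalizing k with
  | zero => simpa using hd k
  | succ m ih =>
    refine ih (fun k => hw.dvd_of_dvd_act hf hfb (act_mem_bddSeries w _ hh) (fun k => ?_) k) k
    rw [← act_mul, ← pow_succ']
    exact hd k

/-- The case d = 0 of divisibility. Boundedness is essential: 1 - x kills the two-sided series Σ
x^k. -/
theorem IsVertexWeight.eq_of_act_pow_eq (hw : IsVertexWeight Δ b w ε) {f : Laurent R n}
    (hf : SuppIn f (dilation Δ 1)) (hfb : IsUnit (f.coeff b)) {h h' : Series R n}
    (hh : h ∈ bddSeries R w) (hh' : h' ∈ bddSeries R w) (m : ℕ)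
    (he : act (f ^ m) h = act (f ^ m) h') : h = h' := by
  ext k
  refine sub_eq_zero.1 (zero_dvd_iff.1 (hw.dvd_of_dvd_act_pow hf hfb
    (Submodule.sub_mem _ hh hh') m (fun k => ?_) k))
  rw [map_sub, he, sub_self]
  exact dvd_rfl

end Action

/-! ### The expansion of g / f^m at b, characterised by multiplication by f^m. -/

section Expansion

variable {R : Type*} [CommRing R] {n : ℕ} {Δ : Set (Fin n → ℝ)} {b : Fin n → ℤ}
  {w : (Fin n → ℤ) →+ ℝ} {ε : ℝ} {f : Laurent R n}

theorem single_mul_one_add_tail (hfb : IsUnit (f.coeff b)) :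
    single b (f.coeff b) * (1 + tail f b) = f := by
  rw [tail, add_sub_cancel, ← mul_assoc, AddMonoidAlgebra.single_mul_single, add_neg_cancel,
    Ring.mul_inverse_cancel _ hfb]
  exact one_mul f

theorem coeff_tail (hfb : IsUnit (f.coeff b)) (k : Fin n → ℤ) :
    (tail f b).coeff k = if k = 0 then 0 else Ring.inverse (f.coeff b) * f.coeff (k + b) := by
  classical
  rw [tail, AddMonoidAlgebra.coeff_sub, Finsupp.sub_apply, coeff_single_mul', sub_neg_eq_add,
    AddMonoidAlgebra.one_def, AddMonoidAlgebra.coeff_single, Finsupp.single_apply]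
  rcases eq_or_ne k 0 with rfl | hk
  · simp [Ring.inverse_mul_cancel _ hfb]
  · simp [hk, hk.symm]

theorem IsVertexWeight.suppIn_tail_pow (hw : IsVertexWeight Δ b w ε)
    (hf : SuppIn f (dilation Δ 1)) (hfb : IsUnit (f.coeff b)) (j : ℕ) :
    SuppIn (tail f b ^ j) {k | j * ε ≤ w k} := by
  induction j with
  | zero => rw [pow_zero]; exact suppIn_one (by simp)
  | succ j ih =>
    rw [pow_succ]
    have h1 : SuppIn (tail f b) {k | ε ≤ w k} := by
      intro k hk
      rw [coeff_tail hfb] at hk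
      split_ifs at hk with h0
      · exact absurd rfl hk
      · have h2 := hw.gap (k + b) (mem_dilation_one.1 (hf _ (right_ne_zero_of_mul hk)))
          (by simpa using h0)
        rw [map_add] at h2
        simp only [Set.mem_ofPred_eq]
        linarith
    refine ih.mul h1 fun x hx y hy => ?_
    simp only [Set.mem_ofPred_eq, map_add] at *
    push_cast
    linarith

theorem IsVertexWeight.suppIn_tail_pow_vertexCone (hw : IsVertexWeight Δ b w ε)
    (hf : SuppIn f (dilation Δ 1)) (hfb : IsUnit (f.coeff b)) (j : ℕ) :
    SuppIn (tail f b ^ j) {k | toReal k ∈ vertexCone Δ b} := by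
  refine SuppIn.pow_of_add_mem (fun k hk => ?_) ?_ (fun x hx y hy => ?_) j
  · rw [coeff_tail hfb] at hk
    split_ifs at hk with h0
    · exact absurd rfl hk
    · simpa using dilation_sub_mem_vertexCone (b := b) (hf _ (right_ne_zero_of_mul hk))
  · simpa [toReal_zero] using vertexCone_zero ⟨_, hw.mem⟩
  · simp only [Set.mem_ofPred_eq, toReal_add] at *
    exact vertexCone_add hw.convex hx hy

/-- Every exponent of ℓ^j has weight at least jε, so a fixed coefficient sees only finitely many j;
finite truncations can then replace the infinite sum. -/
theorem IsVertexWeight.eventually_coeff_mul_tail_pow (hw : IsVertexWeight Δ b w ε)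
    (hf : SuppIn f (dilation Δ 1)) (hfb : IsUnit (f.coeff b)) (g : Laurent R n)
    (k : Fin n → ℤ) : ∀ᶠ j in atTop, (g * tail f b ^ j).coeff k = 0 := by
  have h1 : ∀ᶠ j : ℕ in atTop, ∀ v ∈ g.coeff.support, w k - w v < j * ε := by
    rw [Filter.eventually_all_finset]
    intro v _
    filter_upwards [eventually_gt_atTop ⌈(w k - w v) / ε⌉₊] with j hj
    rw [← div_lt_iff₀ hw.pos]
    exact (Nat.le_ceil _).trans_lt (by exact_mod_cast hj)
  filter_upwards [h1] with j hj
  have h2 : SuppIn (g * tail f b ^ j) {k | ∃ v ∈ g.coeff.support, w v + j * ε ≤ w k} := by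
    refine SuppIn.mul (A := (g.coeff.support : Set (Fin n → ℤ)))
      (fun v hv => Finsupp.mem_support_iff.2 hv) (hw.suppIn_tail_pow hf hfb j) fun x hx y hy => ?_
    refine ⟨x, hx, ?_⟩
    simp only [Set.mem_ofPred_eq, map_add] at *
    linarith
  refine h2.eq_zero ?_
  rintro ⟨v, hv, h3⟩
  linarith [hj v hv]

/-- The partial sums of the expansion of `g / f^m`. -/
def truncExpansion (f : Laurent R n) (b : Fin n → ℤ) (g : Laurent R n) (m N : ℕ) : Laurent R n :=
  Ring.inverse (f.coeff b) ^ m • (g * single (-(m • b)) 1 *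
    ∑ j ∈ Finset.range N, ((-1) ^ j * (Nat.multichoose m j : R)) • tail f b ^ j)

theorem IsVertexWeight.eventually_expansion_eq (hw : IsVertexWeight Δ b w ε)
    (hf : SuppIn f (dilation Δ 1)) (hfb : IsUnit (f.coeff b)) (g : Laurent R n) (m : ℕ)
    (k : Fin n → ℤ) :
    ∀ᶠ N in atTop, expansion f b g m k = (truncExpansion f b g m N).coeff k := by
  obtain ⟨N₀, hN₀⟩ := eventually_atTop.1
    (hw.eventually_coeff_mul_tail_pow hf hfb (g * single (-(m • b)) 1) k)
  filter_upwards [eventually_ge_atTop N₀] with N hN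
  rw [expansion, truncExpansion, AddMonoidAlgebra.coeff_smul_apply, smul_eq_mul, Finset.mul_sum,
    AddMonoidAlgebra.coeff_sum, Finsupp.finsetSum_apply]
  congr 1
  rw [finsum_eq_sum_of_support_subset (s := Finset.range N)]
  · refine Finset.sum_congr rfl fun j _ => ?_
    rw [mul_smul_comm, AddMonoidAlgebra.coeff_smul_apply, smul_eq_mul]
  · intro j hj
    rw [Finset.coe_range, Set.mem_Iio]
    by_contra h
    refine hj ?_
    simp only [hN₀ j (by omega), mul_zero]

theorem mul_truncExpansion_succ (hfb : IsUnit (f.coeff b)) (g : Laurent R n) (m N : ℕ) :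
    f * truncExpansion f b g (m + 1) (N + 1) = truncExpansion f b g m (N + 1) +
      (Ring.inverse (f.coeff b) ^ m * ((-1) ^ N * (Nat.multichoose (m + 1) N : R))) •
        (g * single (-(m • b)) 1 * tail f b ^ (N + 1)) := by
  -- Truncated form of (1+ℓ)(1+ℓ)^{-(m+1)} = (1+ℓ)^{-m}: Pascal's rule telescopes and leaves one
  -- error term in ℓ^{N+1}.
  have key : ∀ N : ℕ, (1 + tail f b) * ∑ j ∈ Finset.range (N + 1),
        ((-1) ^ j * (Nat.multichoose (m + 1) j : R)) • tail f b ^ j =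
      ∑ j ∈ Finset.range (N + 1), ((-1) ^ j * (Nat.multichoose m j : R)) • tail f b ^ j +
        ((-1) ^ N * (Nat.multichoose (m + 1) N : R)) • tail f b ^ (N + 1) := by
    intro N
    induction N with
    | zero => simp
    | succ N ih =>
      rw [Finset.sum_range_succ, mul_add, ih, Finset.sum_range_succ _ (N + 1),
        Nat.multichoose_succ_succ m N]
      simp only [Algebra.smul_def]
      push_cast [map_mul, map_add, map_pow, map_neg, map_one]
      ring
  have hs : single b (f.coeff b) * single (-((m + 1) • b)) (1 : R) =
      f.coeff b • single (-(m • b)) (1 : R) := by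
    rw [AddMonoidAlgebra.single_mul_single, AddMonoidAlgebra.smul_single, smul_eq_mul]
    congr 1
    rw [succ_nsmul]
    abel
  nth_rw 1 [← single_mul_one_add_tail hfb]
  rw [truncExpansion, truncExpansion]
  generalize hX : ∑ j ∈ Finset.range (N + 1),
        ((-1) ^ j * (Nat.multichoose (m + 1) j : R)) • tail f b ^ j = X at *
  calc _ = Ring.inverse (f.coeff b) ^ (m + 1) •
        (g * (single b (f.coeff b) * single (-((m + 1) • b)) (1 : R)) *
          ((1 + tail f b) * X)) := by
        rw [mul_smul_comm]; congr 1; ring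
    _ = (Ring.inverse (f.coeff b) ^ m * (Ring.inverse (f.coeff b) * f.coeff b)) •
        (g * single (-(m • b)) (1 : R) * ((1 + tail f b) * X)) := by
        rw [hs, mul_smul_comm, smul_mul_assoc, smul_smul, pow_succ, mul_assoc]
    _ = _ := by
        rw [Ring.inverse_mul_cancel _ hfb, mul_one, ← hX, key N, mul_add, smul_add,
          mul_smul_comm (_ * _ : R), smul_smul]

theorem IsVertexWeight.act_expansion_succ (hw : IsVertexWeight Δ b w ε)
    (hf : SuppIn f (dilation Δ 1)) (hfb : IsUnit (f.coeff b)) (g : Laurent R n) (m : ℕ) :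
    act f (expansion f b g (m + 1)) = expansion f b g m := by
  ext k
  have h1 : ∀ᶠ N in atTop, ∀ j ∈ f.coeff.support,
      expansion f b g (m + 1) (k - j) = (truncExpansion f b g (m + 1) N).coeff (k - j) := by
    rw [Filter.eventually_all_finset]
    exact fun j _ => hw.eventually_expansion_eq hf hfb g (m + 1) (k - j)
  obtain ⟨N, ha, hb', hc⟩ := ((tendsto_add_atTop_nat 1).eventually (h1.and
    ((hw.eventually_expansion_eq hf hfb g m k).and
      (hw.eventually_coeff_mul_tail_pow hf hfb (g * single (-(m • b)) 1) k)))).exists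
  rw [hb', act_apply, Finset.sum_congr rfl fun j hj => by rw [ha j hj]]
  have h2 := mul_truncExpansion_succ hfb g m N
  have h3 := congrArg (fun q : Laurent R n => q.coeff k) h2
  simp only [AddMonoidAlgebra.coeff_add, Finsupp.add_apply, AddMonoidAlgebra.coeff_smul_apply, hc,
    smul_zero, add_zero] at h3
  rw [← h3, ← toSeries_apply, ← act_toSeries, act_apply]
  rfl

theorem expansion_zero (g : Laurent R n) : expansion f b g 0 = toSeries g := by
  ext k
  rw [expansion, finsum_eq_single _ 0]
  · simp [toSeries_apply, ← AddMonoidAlgebra.one_def]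
  · intro j hj
    obtain ⟨j, rfl⟩ := Nat.exists_eq_succ_of_ne_zero hj
    simp

theorem IsVertexWeight.act_pow_expansion_add (hw : IsVertexWeight Δ b w ε)
    (hf : SuppIn f (dilation Δ 1)) (hfb : IsUnit (f.coeff b)) (g : Laurent R n) (r m : ℕ) :
    act (f ^ r) (expansion f b g (m + r)) = expansion f b g m := by
  induction r with
  | zero => simp
  | succ r ih => rw [pow_succ, act_mul, ← add_assoc, hw.act_expansion_succ hf hfb, ih]

theorem IsVertexWeight.act_pow_expansion (hw : IsVertexWeight Δ b w ε)
    (hf : SuppIn f (dilation Δ 1)) (hfb : IsUnit (f.coeff b)) (g : Laurent R n) (m : ℕ) :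
    act (f ^ m) (expansion f b g m) = toSeries g := by
  have := hw.act_pow_expansion_add hf hfb g m 0
  rwa [zero_add, expansion_zero] at this

/-- The expansion of `g / f^m` as a linear function of `g`. -/
def IsVertexWeight.expansionLinear (hw : IsVertexWeight Δ b w ε)
    (hf : SuppIn f (dilation Δ 1)) (hfb : IsUnit (f.coeff b)) (m : ℕ) :
    Laurent R n →ₗ[R] Series R n where
  toFun g := expansion f b g m
  map_add' g q := by
    ext k
    obtain ⟨N, h1, h2, h3⟩ := ((hw.eventually_expansion_eq hf hfb (g + q) m k).and
      ((hw.eventually_expansion_eq hf hfb g m k).and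
        (hw.eventually_expansion_eq hf hfb q m k))).exists
    rw [Pi.add_apply, h1, h2, h3, ← Finsupp.add_apply, ← AddMonoidAlgebra.coeff_add]
    simp only [truncExpansion, add_mul, smul_add]
  map_smul' a g := by
    ext k
    obtain ⟨N, h1, h2⟩ := ((hw.eventually_expansion_eq hf hfb (a • g) m k).and
      (hw.eventually_expansion_eq hf hfb g m k)).exists
    rw [RingHom.id_apply, Pi.smul_apply, h1, h2, ← AddMonoidAlgebra.coeff_smul_apply]
    simp only [truncExpansion, smul_mul_assoc, smul_comm a]

theorem IsVertexWeight.expansion_mem_omegaFormal (hw : IsVertexWeight Δ b w ε)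
    (hf : SuppIn f (dilation Δ 1)) (hfb : IsUnit (f.coeff b)) {g : Laurent R n} {m : ℕ}
    (hg : SuppIn g (dilation Δ m)) : expansion f b g m ∈ OmegaFormal R Δ b := by
  intro k hk
  have h1 : SuppIn (g * single (-(m • b)) 1) {k | toReal k ∈ vertexCone Δ b} :=
    hg.mul (suppIn_single (A := {-(m • b)}) rfl) fun x hx y hy => by
      rw [Set.mem_singleton_iff.1 hy]
      exact dilation_sub_mem_vertexCone hx
  have h2 : ∀ j, (g * single (-(m • b)) 1 * tail f b ^ j).coeff k = 0 := fun j =>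
    (h1.mul (hw.suppIn_tail_pow_vertexCone hf hfb j) (C := {k | toReal k ∈ vertexCone Δ b})
      fun x hx y hy => by
        simp only [Set.mem_ofPred_eq, toReal_add] at *
        exact vertexCone_add hw.convex hx hy).eq_zero hk
  simp only [expansion, h2, mul_zero, finsum_zero]

end Expansion

/-! ### Compatibility of multiplication with σ, δ and the Cartier operator. -/

section Coefficients

variable {R : Type*} [CommRing R] {n : ℕ}

theorem act_twist (σ : R →+* R) (f : Laurent R n) (h : Series R n) :
    act (twist σ f) (fun k => σ (h k)) = fun k => σ (act f h k) := by
  induction f using AddMonoidAlgebra.induction_linear with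
  | zero => ext; simp [twist]
  | add x y hx hy =>
    rw [twist] at *
    rw [map_add, act_add, hx, hy]
    ext k
    simp
  | single j a =>
    ext k
    rw [twist, AddMonoidAlgebra.mapRingHom_single, act_single, act_single, map_mul]

theorem derivSeries_act (δ : Derivation ℤ R R) (f : Laurent R n) (h : Series R n) :
    derivSeries δ (act f h) = act f (derivSeries δ h) +
      act (AddMonoidAlgebra.map (δ : R →+ R) f) h := by
  induction f using AddMonoidAlgebra.induction_linear with
  | zero => ext; simp [derivSeries]
  | add x y hx hy =>
    have h1 : derivSeries δ (act (x + y) h) = derivSeries δ (act x h) + derivSeries δ (act y h) := by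
      ext; simp [derivSeries]
    rw [h1, AddMonoidAlgebra.map_add, act_add, act_add, hx, hy]
    abel
  | single j a =>
    ext k
    rw [Pi.add_apply, AddMonoidAlgebra.map_single, act_single, act_single, derivSeries, act_single,
      derivSeries, Derivation.leibniz]
    simp [mul_comm]

theorem nsmul_injective {p : ℕ} (hp : p ≠ 0) :
    Function.Injective (fun k : Fin n → ℤ => p • k) := fun k l h => by
  ext i
  have := congrFun h i
  simpa [hp] using this

/-- Substitution of `x^p` for `x` in a Laurent polynomial. -/
def expand (p : ℕ) : Laurent R n →+* Laurent R n :=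
  AddMonoidAlgebra.mapDomainRingHom R (nsmulAddMonoidHom p : (Fin n → ℤ) →+ (Fin n → ℤ))

theorem expand_single (p : ℕ) (j : Fin n → ℤ) (a : R) :
    expand p (single j a) = single (p • j) a := by
  simp [expand]

/-- The Cartier operator on Laurent polynomials. -/
def cartierLaurent {p : ℕ} (hp : p ≠ 0) (g : Laurent R n) : Laurent R n :=
  AddMonoidAlgebra.comapDomain (fun k => p • k) (nsmul_injective hp) g

theorem coeff_cartierLaurent {p : ℕ} (hp : p ≠ 0) (g : Laurent R n) (k : Fin n → ℤ) :
    (cartierLaurent hp g).coeff k = g.coeff (p • k) := by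
  simp [cartierLaurent]

/-- The Cartier operator as a linear map. -/
def cartierLinear (R : Type*) [CommRing R] (n p : ℕ) : Series R n →ₗ[R] Series R n where
  toFun := cartier p
  map_add' _ _ := rfl
  map_smul' _ _ := rfl

theorem cartierLinear_apply (p : ℕ) (h : Series R n) (k : Fin n → ℤ) :
    cartierLinear R n p h k = h (p • k) := rfl

theorem toSeries_cartierLaurent {p : ℕ} (hp : p ≠ 0) (g : Laurent R n) :
    toSeries (cartierLaurent hp g) = cartierLinear R n p (toSeries g) := by
  ext k
  exact coeff_cartierLaurent hp g k

/-- The projection formula g · C_p(h) = C_p(g(x^p) h), which lets denominators f'(x^p) pass through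
C_p as f'. -/
theorem act_cartier (p : ℕ) (g : Laurent R n) (h : Series R n) :
    act g (cartierLinear R n p h) = cartierLinear R n p (act (expand p g) h) := by
  induction g using AddMonoidAlgebra.induction_linear with
  | zero => simp
  | add x y hx hy => rw [map_add (expand p), act_add, act_add, hx, hy, map_add]
  | single j a =>
    ext k
    rw [expand_single, act_single, cartierLinear_apply, cartierLinear_apply, act_single, nsmul_sub]

theorem cartierLinear_mem_omegaFormal {p : ℕ} (hp : 0 < p) {Δ : Set (Fin n → ℝ)}
    {b : Fin n → ℤ} {h : Series R n} (hh : h ∈ OmegaFormal R Δ b) :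
    cartierLinear R n p h ∈ OmegaFormal R Δ b :=
  fun _ hk => hh _ fun h' => hk (vertexCone_of_nsmul hp h')

end Coefficients

end

/-! ### Consequences of p-adic completeness of R. -/

section Adic

variable {R : Type*} [CommRing R] (p : ℕ)

theorem mem_span_pow_smul_top {M : Type*} [AddCommGroup M] [Module R M] (s : ℕ) (x : M) :
    x ∈ (Ideal.span {(p : R)} ^ s • ⊤ : Submodule R M) ↔ ∃ y : M, x = (p : R) ^ s • y := by
  rw [Ideal.span_singleton_pow, Submodule.ideal_span_singleton_smul,
    Submodule.mem_smul_pointwise_iff_exists]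
  simp [eq_comm]

theorem eq_zero_of_forall_pow_dvd [IsHausdorff (Ideal.span {(p : R)}) R] {x : R}
    (h : ∀ s : ℕ, (p : R) ^ s ∣ x) : x = 0 := by
  refine IsHausdorff.haus (I := Ideal.span {(p : R)}) inferInstance x fun s => ?_
  rw [SModEq.zero, mem_span_pow_smul_top]
  exact h s

theorem exists_limit [IsPrecomplete (Ideal.span {(p : R)}) R] (c : ℕ → R)
    (h : ∀ s, (p : R) ^ s ∣ c (s + 1) - c s) : ∃ L : R, ∀ s, (p : R) ^ s ∣ L - c s := by
  have hc : ∀ {m n : ℕ}, m ≤ n → (p : R) ^ m ∣ c n - c m := by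
    intro m n hmn
    induction n, hmn using Nat.le_induction with
    | base => simp
    | succ n hmn ih =>
      rw [← sub_add_sub_cancel]
      exact dvd_add ((pow_dvd_pow _ hmn).trans (h n)) ih
  obtain ⟨L, hL⟩ := IsPrecomplete.prec (I := Ideal.span {(p : R)}) (M := R) inferInstance (f := c)
    fun {m n} hmn => by
      rw [SModEq.comm, SModEq.sub_mem, mem_span_pow_smul_top]
      exact hc hmn
  refine ⟨L, fun s => ?_⟩
  have := hL s
  rw [SModEq.comm, SModEq.sub_mem, mem_span_pow_smul_top] at this
  exact this

/-- By completeness p lies in the Jacobson radical. -/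
theorem isUnit_of_isUnit_mod [IsAdicComplete (Ideal.span {(p : R)}) R] {x y : R}
    (h : (p : R) ∣ x * y - 1) : IsUnit x := by
  obtain ⟨z, hz⟩ := h
  have hp : (p : R) ∈ (⊥ : Ideal R).jacobson :=
    IsAdicComplete.le_jacobson_bot _ (Ideal.mem_span_singleton_self _)
  have := Ideal.mem_jacobson_bot.1 hp z
  rw [← hz, sub_add_cancel] at this
  exact isUnit_of_mul_isUnit_left this

theorem isUnit_intCast_of_coprime [IsAdicComplete (Ideal.span {(p : R)}) R] {m : ℤ}
    (h : IsCoprime m p) : IsUnit (m : R) := by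
  obtain ⟨a, c, hac⟩ := h
  refine isUnit_of_isUnit_mod p (y := (a : R)) ⟨-c, ?_⟩
  have := congrArg (Int.cast : ℤ → R) hac
  push_cast at this
  linear_combination this

end Adic

/-! ### The completed module as the set of series Σ p^i g_i. -/

section Completion

variable {R : Type*} [CommRing R] {n : ℕ} {p : ℕ} {f : Laurent R n} {b : Fin n → ℤ}
  {μ Δ : Set (Fin n → ℝ)}

/-- A Cauchy sequence in the completion telescopes into Σ p^i g_i. All later work uses this concrete
form instead of the inverse limit. -/
theorem mem_OmegaHat {h : Series R n} : h ∈ OmegaHat p f b μ ↔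
    ∃ g : ℕ → Series R n, (∀ i, g i ∈ Omega f b μ) ∧
      ∀ s k, (p : R) ^ s ∣ h k - ∑ i ∈ Finset.range s, (p : R) ^ i * g i k := by
  set I := Ideal.span {(p : R)}
  have hval : ∀ (x : AdicCompletion.AdicCauchySequence I (Omega f b μ)),
      AdicCompletion.map I (Omega f b μ).subtype (AdicCompletion.mk I _ x) =
        AdicCompletion.of I _ h ↔ ∀ s k, (p : R) ^ s ∣ h k - (x s : Series R n) k := by
    intro x
    rw [AdicCompletion.map_mk, AdicCompletion.ext_iff]
    refine forall_congr' fun s => ?_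
    rw [AdicCompletion.of_apply, AdicCompletion.mk_apply_coe, eq_comm, Submodule.mkQ_apply,
      Submodule.mkQ_apply, Submodule.Quotient.eq, mem_span_pow_smul_top]
    constructor
    · rintro ⟨y, hy⟩ k
      exact ⟨y k, congrFun hy k⟩
    · intro hk
      choose y hy using hk
      exact ⟨y, funext hy⟩
  rw [OmegaHat, Submodule.mem_comap, LinearMap.mem_range]
  constructor
  · rintro ⟨y, hy⟩
    obtain ⟨x, rfl⟩ := AdicCompletion.mk_surjective I _ y
    have hx := (hval x).1 hy
    have hd : ∀ s, ∃ g : Omega f b μ, x (s + 1) - x s = (p : R) ^ s • g := fun s =>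
       (mem_span_pow_smul_top p s _).1 (SModEq.sub_mem.1 (x.2 (Nat.le_succ s)).symm)
    choose g hg using hd
    have hsum : ∀ s, (x s : Series R n) = x 0 + ∑ i ∈ Finset.range s, (p : R) ^ i • (g i).1 := by
      intro s
      induction s with
      | zero => simp
      | succ s ih =>
        rw [Finset.sum_range_succ, ← add_assoc, ← ih, ← Submodule.coe_smul, ← hg]
        simp
    -- The starting value x 0 is arbitrary, being constrained only modulo p^0, and is absorbed into
    -- the term of index 0.
    refine ⟨fun i => g i + if i = 0 then x 0 else 0, fun i => ?_, fun s k => ?_⟩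
    · dsimp only
      split_ifs
      · exact Submodule.add_mem _ (g i).2 (x 0).2
      · simp
    · cases s with
      | zero => simp
      | succ s =>
        convert hx (s + 1) k using 2
        rw [hsum, Finset.sum_range_succ', Finset.sum_range_succ']
        simp
        ring
  · rintro ⟨g, hg, hs⟩
    have hmem : ∀ s, ∑ i ∈ Finset.range s, (p : R) ^ i • g i ∈ Omega f b μ := fun s =>
      Submodule.sum_mem _ fun i _ => Submodule.smul_mem _ _ (hg i)
    refine ⟨AdicCompletion.mk I _ (AdicCompletion.AdicCauchySequence.mk I _
      (fun s => ⟨_, hmem s⟩) fun s => ?_), ?_⟩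
    · rw [SModEq.comm, SModEq.sub_mem, mem_span_pow_smul_top]
      refine ⟨⟨g s, hg s⟩, Subtype.ext ?_⟩
      simp [Finset.sum_range_succ]
    · refine (hval _).2 fun s k => ?_
      convert hs s k using 2
      change (∑ i ∈ Finset.range s, (p : R) ^ i • g i) k = _
      simp

theorem Omega_le_OmegaHat : Omega f b μ ≤ OmegaHat p f b μ := by
  intro h hh
  rw [mem_OmegaHat]
  refine ⟨fun i => if i = 0 then h else 0, fun i => ?_, fun s k => ?_⟩
  · dsimp only
    split_ifs
    · exact hh
    · exact Submodule.zero_mem _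
  · cases s with
    | zero => simp
    | succ s => simp [Finset.sum_range_succ']

/-- The completion is itself p-adically closed: the double series Σ p^{i+j} g_{ij} is summed along
its diagonals. -/
theorem mem_OmegaHat_of_series {h : Series R n} {e : ℕ → Series R n}
    (he : ∀ i, e i ∈ OmegaHat p f b μ)
    (hs : ∀ s k, (p : R) ^ s ∣ h k - ∑ i ∈ Finset.range s, (p : R) ^ i * e i k) :
    h ∈ OmegaHat p f b μ := by
  have he' := fun i => mem_OmegaHat.1 (he i)
  choose g hg hgs using he'
  refine mem_OmegaHat.2 ⟨fun m => ∑ i ∈ Finset.range (m + 1), g i (m - i),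
    fun m => Submodule.sum_mem _ fun i _ => hg _ _, fun s k => ?_⟩
  have h1 : ∑ m ∈ Finset.range s, (p : R) ^ m * (∑ i ∈ Finset.range (m + 1), g i (m - i)) k =
      ∑ i ∈ Finset.range s, ∑ j ∈ Finset.range (s - i), (p : R) ^ (i + j) * g i j k := by
    rw [← Finset.sum_range_diag_flip s fun i j => (p : R) ^ (i + j) * g i j k]
    refine Finset.sum_congr rfl fun m _ => ?_
    rw [Finset.sum_apply, Finset.mul_sum]
    refine Finset.sum_congr rfl fun i hi => ?_
    rw [Nat.add_sub_cancel' (by simpa [Nat.lt_succ_iff] using hi)]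
  rw [h1, ← sub_add_sub_cancel, ← Finset.sum_sub_distrib]
  refine dvd_add (hs s k) (Finset.dvd_sum fun i hi => ?_)
  have h2 := mul_dvd_mul_left ((p : R) ^ i) (hgs i (s - i) k)
  rw [← pow_add, Nat.add_sub_cancel' (Finset.mem_range.1 hi).le, mul_sub, Finset.mul_sum] at h2
  simpa [pow_add, mul_assoc] using h2

/-- Splits off the term of index 0; p is cancelled from the remaining congruences, being a
non-zero-divisor. -/
theorem exists_eq_add_smul_of_mem_OmegaHat [IsDomain R] [CharZero R] (hp : p ≠ 0) {h : Series R n}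
    (hh : h ∈ OmegaHat p f b μ) :
    ∃ g ∈ Omega f b μ, ∃ h' ∈ OmegaHat p f b μ, h = g + (p : R) • h' := by
  obtain ⟨g, hg, hs⟩ := mem_OmegaHat.1 hh
  have h1 : ∀ k, (p : R) ∣ h k - g 0 k := fun k => by simpa using hs 1 k
  choose h' hh' using h1
  refine ⟨g 0, hg 0, h', mem_OmegaHat.2 ⟨fun i => g (i + 1), fun i => hg _, fun s k => ?_⟩,
    funext fun k => ?_⟩
  · have h2 := hs (s + 1) k
    rw [Finset.sum_range_succ', pow_zero, one_mul, add_comm (Finset.sum _ _), ← sub_sub, hh', pow_succ'] at h2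
    have h3 : (p : R) * h' k - ∑ i ∈ Finset.range s, (p : R) ^ (i + 1) * g (i + 1) k =
        p * (h' k - ∑ i ∈ Finset.range s, (p : R) ^ i * g (i + 1) k) := by
      rw [mul_sub, Finset.mul_sum]
      simp only [pow_succ', mul_assoc]
    rw [h3] at h2
    exact (mul_dvd_mul_iff_left (Nat.cast_ne_zero.2 hp)).1 h2
  · rw [Pi.add_apply, Pi.smul_apply, smul_eq_mul, ← hh']
    ring

theorem OmegaHat_le_of_Omega_le [IsHausdorff (Ideal.span {(p : R)}) R]
    (h : Omega f b μ ≤ OmegaFormal R Δ b) : OmegaHat p f b μ ≤ OmegaFormal R Δ b := by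
  intro x hx k hk
  obtain ⟨g, hg, hs⟩ := mem_OmegaHat.1 hx
  refine eq_zero_of_forall_pow_dvd p fun s => ?_
  have h1 := hs s k
  rwa [Finset.sum_eq_zero fun i _ => by rw [h (hg i) k hk, mul_zero], sub_zero] at h1

end Completion

/-! ### Formal derivatives characterised by divisibility of coefficients. -/

section FormalDerivatives

variable {R : Type*} [CommRing R] {n : ℕ} {p : ℕ} {b : Fin n → ℤ} {Δ : Set (Fin n → ℝ)}

theorem pow_dvd_of_mem_dOmegaFormal {h : Series R n} (hh : h ∈ dOmegaFormal R Δ b) (s : ℕ)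
    (k : Fin n → ℤ) : (p : R) ^ s ∣ h (p ^ s • k) := by
  induction hh using Submodule.span_induction with
  | mem x hx =>
    obtain ⟨i, h, -, rfl⟩ := hx
    refine Dvd.dvd.mul_right ?_ _
    simp
  | zero => simp
  | add x y _ _ hx hy => exact dvd_add hx hy
  | smul a x _ hx => exact hx.mul_left a

theorem exists_eq_pow_smul (hp : p.Prime) {k : Fin n → ℤ} (hk : k ≠ 0) :
    ∃ (s : ℕ) (k' : Fin n → ℤ) (i : Fin n), k = p ^ s • k' ∧ ¬ (p : ℤ) ∣ k' i := by
  obtain ⟨i, hi⟩ : ∃ i, k i ≠ 0 := by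
    by_contra! h
    exact hk (funext h)
  have hfin : FiniteMultiplicity (p : ℤ) (k i) := Int.finiteMultiplicity_iff.2
    ⟨by simpa using hp.one_lt.ne', hi⟩
  obtain ⟨N, hN⟩ := hfin
  classical
  have hex : ∃ s, ¬ ∀ i, (p : ℤ) ^ (s + 1) ∣ k i := ⟨N, fun h => hN (h i)⟩
  obtain ⟨s, h1, hmin⟩ : ∃ s, (¬ ∀ i, (p : ℤ) ^ (s + 1) ∣ k i) ∧
      ∀ m < s, ∀ i, (p : ℤ) ^ (m + 1) ∣ k i :=
    ⟨Nat.find hex, Nat.find_spec hex, fun m hm => not_not.1 (Nat.find_min hex hm)⟩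
  have h2 : ∀ i, (p : ℤ) ^ s ∣ k i := by
    cases s with
    | zero => simp
    | succ s => exact hmin s s.lt_succ_self
  choose k' hk' using h2
  push Not at h1
  obtain ⟨j, hj⟩ := h1
  refine ⟨s, k', j, ?_, fun h => hj ?_⟩
  · ext i
    rw [hk' i]
    simp
  · rw [hk' j, pow_succ]
    exact mul_dvd_mul_left _ h

variable [IsAdicComplete (Ideal.span {(p : R)}) R]

/-- Write k = p^s k' with some k'_i prime to p. Then k'_i is a unit and p^s divides h_k, so k_i
divides h_k and the monomial can be integrated in the variable x_i. At k = 0 separatedness gives h_0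
= 0. -/
theorem mem_dOmegaFormal (hp : p.Prime) {h : Series R n} (hh : h ∈ OmegaFormal R Δ b)
    (hd : ∀ s k, (p : R) ^ s ∣ h (p ^ s • k)) : h ∈ dOmegaFormal R Δ b := by
  classical
  have h0 : h 0 = 0 := eq_zero_of_forall_pow_dvd p fun s => by simpa using hd s 0
  have key : ∀ k : Fin n → ℤ, ∃ c : Fin n → R, h k = ∑ i, (k i : R) * c i ∧
      (h k = 0 → c = 0) := by
    intro k
    by_cases hk : h k = 0
    · exact ⟨0, by simp [hk], fun _ => rfl⟩
    obtain ⟨s, k', i, hkk, hi⟩ := exists_eq_pow_smul hp (k := k) (by rintro rfl; exact hk h0)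
    have hu : IsUnit ((k' i : ℤ) : R) := isUnit_intCast_of_coprime p
      ((Nat.prime_iff_prime_int.1 hp).coprime_iff_not_dvd.2 hi).symm
    obtain ⟨y, hy⟩ := hd s k'
    obtain ⟨t, ht⟩ := hu.exists_right_inv
    refine ⟨Pi.single i (t * y), ?_, fun h => absurd h hk⟩
    rw [Finset.sum_eq_single i (fun j _ hj => by simp [hj]) (by simp), Pi.single_eq_same,
      hkk, hy]
    simp only [Pi.smul_apply, nsmul_eq_mul]
    push_cast
    linear_combination -(p : R) ^ s * y * ht
  choose c hc hc0 using key
  have hsum : h = ∑ i, theta i fun k => c k i := by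
    ext k
    rw [Finset.sum_apply, hc k]
    rfl
  rw [hsum]
  refine Submodule.sum_mem _ fun i _ => Submodule.subset_span ⟨i, _, fun k hk => ?_, rfl⟩
  rw [hc0 k (hh k hk)]
  rfl

end FormalDerivatives

/-! ### Valuations of factorials and divisibility of the binomial coefficients. -/

section Numbers

/-- Legendre's formula gives (p-1)a ≤ r-1, so 2a ≤ r-1 for p > 2; then p^{r/2+1} divides p^r/r!. For
p = 2 and r = 2 this fails. -/
theorem factorial_valuation_bound {p r : ℕ} (hp : p.Prime) (hp2 : 2 < p) (hr : 1 ≤ r) :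
    ∃ a t : ℕ, r.factorial = p ^ a * t ∧ t.Coprime p ∧ a + (r / 2 + 1) ≤ r := by
  have : Fact p.Prime := ⟨hp⟩
  obtain ⟨a, t, ht, h⟩ := Nat.exists_eq_pow_mul_and_not_dvd r.factorial_ne_zero p hp.ne_one
  have hval : padicValNat p r.factorial = a := by
    rw [h, padicValNat_base_pow_mul hp.one_lt]
    · rw [padicValNat.eq_zero_of_not_dvd ht, zero_add]
    · rintro rfl
      exact ht (dvd_zero p)
  refine ⟨a, t, h, ((hp.coprime_iff_not_dvd).2 ht).symm, ?_⟩
  have hs := sub_one_mul_padicValNat_factorial (p := p) r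
  have hd : 1 ≤ (p.digits r).sum := by
    have hne : p.digits r ≠ [] := Nat.digits_ne_nil_iff_ne_zero.2 (by omega)
    have h1 := Nat.getLast_digit_ne_zero p (m := r) (by omega)
    have h2 := List.le_sum_of_mem (List.getLast_mem hne)
    omega
  rw [hval] at hs
  have h3 : 2 * a ≤ (p - 1) * a := Nat.mul_le_mul_right _ (by omega)
  omega

theorem factorial_mul_dvd {p : ℕ} (hp : 0 < p) {k : ℕ} (hk : 1 ≤ k) :
    p * k.factorial ∣ (p * k).factorial := by
  have h1 : ∀ k, p * ((k + 1) * k.factorial) ∣ (p * (k + 1)).factorial := by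
    intro k
    induction k with
    | zero => simpa using Nat.dvd_factorial hp le_rfl
    | succ k ih =>
      obtain ⟨q, rfl⟩ := Nat.exists_eq_succ_of_ne_zero hp.ne'
      have h2 : (q + 1) * (k + 1 + 1) = ((q + 1) * (k + 1) + q) + 1 := by ring
      have h3 : ((q + 1) * (k + 1 + 1)).factorial =
          (q + 1) * (k + 1 + 1) * ((q + 1) * (k + 1) + q).factorial := by
        rw [h2, Nat.factorial_succ]
      simp only [Nat.succ_eq_add_one] at *
      rw [← Nat.factorial_succ k] at ih
      rw [h3, ← mul_assoc]
      refine Nat.mul_dvd_mul (dvd_refl _) ?_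
      exact ((Dvd.intro_left _ rfl).trans ih).trans (Nat.factorial_dvd_factorial (by omega))
  obtain ⟨k, rfl⟩ := Nat.exists_eq_succ_of_ne_zero (by omega : k ≠ 0)
  simpa [Nat.factorial_succ] using h1 k

theorem multichoose_mul_factorial {M : ℕ} (hM : 1 ≤ M) (r : ℕ) :
    Nat.multichoose M r * r.factorial * (M - 1).factorial = (M + r - 1).factorial := by
  rw [Nat.multichoose_eq]
  have := Nat.choose_mul_factorial_mul_factorial (n := M + r - 1) (k := r) (by omega)
  rwa [show M + r - 1 - r = M - 1 by omega] at this

variable {R : Type*} [CommRing R] {p : ℕ} [IsAdicComplete (Ideal.span {(p : R)}) R]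

/-- Since multichoose(M, r) (M-1)! = (M+r-1)!/r!, the factorial needed for pole order M+r appears
with coefficient p^r/r!. -/
theorem exists_pow_mul_multichoose_eq (hp : p.Prime) (hp2 : 2 < p) {M : ℕ} (hM : 1 ≤ M) {r : ℕ}
    (hr : 1 ≤ r) : ∃ c : R, (p : R) ^ r * (Nat.multichoose M r : R) * ((M - 1).factorial : R) =
      (p : R) ^ (r / 2 + 1) * c * ((M + r - 1).factorial : R) := by
  obtain ⟨a, t, h, ht, har⟩ := factorial_valuation_bound hp hp2 hr
  have hu : IsUnit ((t : ℤ) : R) := isUnit_intCast_of_coprime p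
    (by exact_mod_cast Nat.isCoprime_iff_coprime.2 ht)
  obtain ⟨y, hy⟩ := hu.exists_right_inv
  rw [Int.cast_natCast] at hy
  refine ⟨(p : R) ^ (r - (a + (r / 2 + 1))) * y, ?_⟩
  have hh : (r.factorial : R) = (p : R) ^ a * t := by rw [h]; push_cast; ring
  have hpow : (p : R) ^ r =
      (p : R) ^ a * (p : R) ^ (r / 2 + 1) * (p : R) ^ (r - (a + (r / 2 + 1))) := by
    rw [← pow_add, ← pow_add, Nat.add_sub_cancel' har]
  have h3 : (Nat.multichoose M r : R) * r.factorial * (M - 1).factorial = (M + r - 1).factorial := by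
    exact_mod_cast congrArg (Nat.cast : ℕ → R) (multichoose_mul_factorial hM r)
  rw [hpow, ← h3, hh]
  linear_combination -(p : R) ^ a * (p : R) ^ (r / 2 + 1) * (p : R) ^ (r - (a + (r / 2 + 1))) *
    Nat.multichoose M r * (M - 1).factorial * hy

end Numbers

/-! ### Truncated negative binomial expansion without denominators. -/

section Binomial

variable {A : Type*} [CommRing A]

theorem sub_mul_sum_multichoose (X Y : A) (M N : ℕ) :
    (X - Y) * ∑ r ∈ Finset.range (N + 1), (Nat.multichoose (M + 1) r : A) * Y ^ r * X ^ (N + 1 - r) =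
      X * ∑ r ∈ Finset.range (N + 1), (Nat.multichoose M r : A) * Y ^ r * X ^ (N + 1 - r) -
        (Nat.multichoose (M + 1) N : A) * Y ^ (N + 1) * X := by
  have hrec : ∀ M N : ℕ, ∑ r ∈ Finset.range (N + 2),
      (Nat.multichoose M r : A) * Y ^ r * X ^ (N + 2 - r) =
      X * ∑ r ∈ Finset.range (N + 1), (Nat.multichoose M r : A) * Y ^ r * X ^ (N + 1 - r) +
        (Nat.multichoose M (N + 1) : A) * Y ^ (N + 1) * X := by
    intro M N
    rw [Finset.sum_range_succ, Finset.mul_sum]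
    congr 1
    · refine Finset.sum_congr rfl fun r hr => ?_
      have := Finset.mem_range.1 hr
      rw [show N + 2 - r = (N + 1 - r) + 1 by omega, pow_succ]
      ring
    · rw [show N + 2 - (N + 1) = 1 by omega, pow_one]
  induction N with
  | zero => simp; ring
  | succ N ih =>
    rw [hrec, hrec, mul_add, mul_left_comm, ih, Nat.multichoose_succ_succ M N]
    push_cast
    ring

/-- This is (X-Y)^{-M} = Σ multichoose(M, r) Y^r X^{-M-r}, cleared of denominators and truncated
modulo Y^N. It is used with X = f'(x^p) and Y = pG. -/
theorem pow_dvd_pow_sub_sum_multichoose (X Y : A) (M N : ℕ) :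
    Y ^ N ∣ X ^ (M + N) - (∑ r ∈ Finset.range N, (Nat.multichoose M r : A) * Y ^ r * X ^ (N - r)) *
      (X - Y) ^ M := by
  cases N with
  | zero => simp
  | succ N =>
    induction M with
    | zero => simp [Finset.sum_range_succ']
    | succ M ih =>
      obtain ⟨c, hc⟩ := ih
      have h := sub_mul_sum_multichoose X Y M N
      refine ⟨X * c + (Nat.multichoose (M + 1) N : A) * X * (X - Y) ^ M, ?_⟩
      rw [pow_succ (X - Y), show M + 1 + (N + 1) = (M + (N + 1)) + 1 by ring, pow_succ X]
      linear_combination X * hc - (X - Y) ^ M * h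

end Binomial

/-! ### Frobenius twists of Laurent polynomials modulo p. -/

section Frobenius

open AddMonoidAlgebra

variable {R : Type*} [CommRing R] {n : ℕ} {p : ℕ}

theorem natCast_mul_eq_smul (d : ℕ) (g : Laurent R n) : (d : Laurent R n) * g = (d : R) • g := by
  rw [← nsmul_eq_mul, Nat.cast_smul_eq_nsmul]

theorem natCast_dvd_iff {d : ℕ} {g : Laurent R n} :
    (d : Laurent R n) ∣ g ↔ ∀ k, (d : R) ∣ g.coeff k := by
  classical
  constructor
  · rintro ⟨q, rfl⟩ k
    rw [natCast_mul_eq_smul]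
    exact ⟨q.coeff k, rfl⟩
  · intro h
    choose c hc using h
    refine ⟨.ofCoeff (Finsupp.onFinset g.coeff.support
      (fun k => if k ∈ g.coeff.support then c k else 0) fun k hk => ?_), ?_⟩
    · by_contra h
      simp [h] at hk
    · rw [natCast_mul_eq_smul]
      ext k
      rw [AddMonoidAlgebra.coeff_smul_apply, AddMonoidAlgebra.coeff_ofCoeff,
        Finsupp.onFinset_apply, smul_eq_mul]
      split_ifs with h
      · exact hc k
      · simpa using h

theorem coeff_expand (hp : p ≠ 0) (g : Laurent R n) (k : Fin n → ℤ) :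
    (expand p g).coeff (p • k) = g.coeff k := by
  change Finsupp.mapDomain (fun k : Fin n → ℤ => p • k) g.coeff (p • k) = _
  exact Finsupp.mapDomain_apply (nsmul_injective hp) _ _

theorem suppIn_expand {μ : Set (Fin n → ℝ)} {g : Laurent R n} {m : ℕ}
    (hg : SuppIn g (dilation μ m)) : SuppIn (expand p g) (dilation μ (p * m)) := by
  classical
  intro k hk
  have h1 : k ∈ (Finsupp.mapDomain (fun k : Fin n → ℤ => p • k) g.coeff).support :=
    Finsupp.mem_support_iff.2 hk
  obtain ⟨j, hj, rfl⟩ := Finset.mem_image.1 (Finsupp.mapDomain_support h1)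
  exact nsmul_mem_dilation (hg j (Finsupp.mem_support_iff.1 hj))

/-- The coefficients of `f'` are congruent modulo `p` to the `p`-th powers of those of `f`. -/
def IsFrobeniusTwist (p : ℕ) (f f' : Laurent R n) : Prop :=
  ∀ k, (p : R) ∣ f'.coeff k - f.coeff k ^ p

/-- The Laurent polynomial obtained by raising the coefficients of `f` to the power `p`. -/
noncomputable def powTwist (hp : p ≠ 0) (f : Laurent R n) : Laurent R n :=
  .ofCoeff (f.coeff.mapRange (fun r => r ^ p) (zero_pow hp))

theorem coeff_powTwist (hp : p ≠ 0) (f : Laurent R n) (k : Fin n → ℤ) :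
    (powTwist hp f).coeff k = f.coeff k ^ p := rfl

theorem isFrobeniusTwist_powTwist (hp : p ≠ 0) (f : Laurent R n) :
    IsFrobeniusTwist p f (powTwist hp f) := fun k => by simp [coeff_powTwist]

theorem isFrobeniusTwist_twist {σ : R →+* R} (hσ : IsFrobeniusLift p σ) (f : Laurent R n) :
    IsFrobeniusTwist p f (twist σ f) := fun k => by
  rw [twist, AddMonoidAlgebra.coeff_mapRingHom]
  exact hσ _

theorem IsFrobeniusTwist.natCast_dvd_sub {f f' f'' : Laurent R n} (h : IsFrobeniusTwist p f f')
    (h' : IsFrobeniusTwist p f f'') : (p : Laurent R n) ∣ f' - f'' := by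
  refine natCast_dvd_iff.2 fun k => ?_
  simpa using dvd_sub (h k) (h' k)

theorem natCast_dvd_expand {g : Laurent R n} (h : (p : Laurent R n) ∣ g) :
    (p : Laurent R n) ∣ expand p g := by
  obtain ⟨q, rfl⟩ := h
  rw [map_mul, map_natCast]
  exact dvd_mul_right _ _

theorem natCast_dvd_add_pow_sub {A : Type*} [CommRing A] (hp : p.Prime) (x y : A) :
    (p : A) ∣ (x + y) ^ p - (x ^ p + y ^ p) := by
  obtain ⟨r, hr⟩ := exists_add_pow_prime_eq hp x y
  exact ⟨x * y * r, by rw [hr]; ring⟩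

theorem natCast_dvd_sum_pow_sub {A ι : Type*} [CommRing A] (hp : p.Prime) (s : Finset ι)
    (x : ι → A) : (p : A) ∣ (∑ i ∈ s, x i) ^ p - ∑ i ∈ s, x i ^ p := by
  classical
  induction s using Finset.induction_on with
  | empty => simp [hp.ne_zero]
  | insert i s hi ih =>
    rw [Finset.sum_insert hi, Finset.sum_insert hi]
    have := dvd_add (natCast_dvd_add_pow_sub hp (x i) (∑ i ∈ s, x i)) ih
    convert this using 1
    ring

theorem natCast_dvd_expand_powTwist_sub (hp : p.Prime) (f : Laurent R n) :
    (p : Laurent R n) ∣ expand p (powTwist hp.ne_zero f) - f ^ p := by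
  induction f using AddMonoidAlgebra.induction_linear with
  | zero =>
    have : powTwist hp.ne_zero (0 : Laurent R n) = 0 := by
      ext k; simp [coeff_powTwist, hp.ne_zero]
    rw [this]
    simp [hp.ne_zero]
  | add x y hx hy =>
    have h1 : (p : Laurent R n) ∣ powTwist hp.ne_zero (x + y) -
        (powTwist hp.ne_zero x + powTwist hp.ne_zero y) := by
      refine natCast_dvd_iff.2 fun k => ?_
      simpa [coeff_powTwist] using natCast_dvd_add_pow_sub hp (x.coeff k) (y.coeff k)
    have h2 := natCast_dvd_expand h1
    rw [map_sub, map_add] at h2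
    have h3 := natCast_dvd_add_pow_sub hp x y
    convert dvd_sub (dvd_add h2 (dvd_add hx hy)) h3 using 1
    ring
  | single j a =>
    have : powTwist hp.ne_zero (single j a : Laurent R n) = single j (a ^ p) := by
      classical
      ext k
      rw [coeff_powTwist, coeff_single, coeff_single, Finsupp.single_apply, Finsupp.single_apply]
      split_ifs <;> simp [hp.ne_zero]
    rw [this, expand_single, AddMonoidAlgebra.single_pow, sub_self]
    exact dvd_zero _

/-- Turns a coefficientwise condition into the congruence f'(x^p) ≡ f^p mod p, which is visibly
multiplicative and produces the remainder G. -/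
theorem isFrobeniusTwist_iff (hp : p.Prime) {f f' : Laurent R n} :
    IsFrobeniusTwist p f f' ↔ (p : Laurent R n) ∣ expand p f' - f ^ p := by
  have h0 := natCast_dvd_expand_powTwist_sub hp f
  constructor
  · intro h
    have h1 := natCast_dvd_expand (h.natCast_dvd_sub (isFrobeniusTwist_powTwist hp.ne_zero f))
    rw [map_sub] at h1
    convert dvd_add h1 h0 using 1
    ring
  · intro h k
    have h1 := dvd_sub h h0
    rw [sub_sub_sub_cancel_right, ← map_sub, natCast_dvd_iff] at h1
    have h2 := h1 (p • k)
    rwa [coeff_expand hp.ne_zero, AddMonoidAlgebra.coeff_sub, Finsupp.sub_apply,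
      coeff_powTwist] at h2

theorem IsFrobeniusTwist.pow (hp : p.Prime) {f f' : Laurent R n} (h : IsFrobeniusTwist p f f')
    (m : ℕ) : IsFrobeniusTwist p (f ^ m) (f' ^ m) := by
  rw [isFrobeniusTwist_iff hp] at *
  rw [map_pow, pow_right_comm]
  exact h.trans (sub_dvd_pow_sub_pow _ _ m)

end Frobenius

noncomputable section

open AddMonoidAlgebra

/-! ### Rational functions with a given numerator inside the span of the ω_u. -/

section OmegaSpan

variable {R : Type*} [CommRing R] {n : ℕ} {Δ μ : Set (Fin n → ℝ)} {b : Fin n → ℤ}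
  {w : (Fin n → ℤ) →+ ℝ} {ε : ℝ} {f : Laurent R n}

theorem IsVertexWeight.expansion_mul_pow (hw : IsVertexWeight Δ b w ε)
    (hf : SuppIn f (dilation Δ 1)) (hfb : IsUnit (f.coeff b)) {g : Laurent R n} {m : ℕ}
    (hg : SuppIn g (dilation Δ m)) (hm : 1 ≤ m) (r : ℕ) :
    expansion f b (g * f ^ r) (m + r) = expansion f b g m := by
  have hgr : SuppIn (g * f ^ r) (dilation Δ (m + r)) := by
    have := hf.pow_dilation hw.convex ⟨_, hw.mem⟩ le_rfl r
    rw [one_mul] at this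
    exact hg.mul_dilation (isFaceOpen_self Δ) hw.convex hm this
  refine hw.eq_of_act_pow_eq hf hfb
    (hw.omegaFormal_le (hw.expansion_mem_omegaFormal hf hfb hgr))
    (hw.omegaFormal_le (hw.expansion_mem_omegaFormal hf hfb hg)) (m + r) ?_
  rw [hw.act_pow_expansion hf hfb, add_comm m, pow_add, act_mul, hw.act_pow_expansion hf hfb,
    act_toSeries, mul_comm]

theorem IsVertexWeight.smul_expansion_mem_Omega (hw : IsVertexWeight Δ b w ε)
    (hf : SuppIn f (dilation Δ 1)) (hfb : IsUnit (f.coeff b)) {g : Laurent R n} {m : ℕ}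
    (hm : 1 ≤ m) (hg : SuppIn g (dilation μ m)) :
    ((m - 1).factorial : R) • expansion f b g m ∈ Omega f b μ := by
  have h1 : Submodule.span R (AddMonoidAlgebra.of' R (Fin n → ℤ) '' g.coeff.support) ≤
      (Omega f b μ).comap (((m - 1).factorial : R) • hw.expansionLinear hf hfb m) := by
    rw [Submodule.span_le]
    rintro _ ⟨v, hv, rfl⟩
    exact Submodule.subset_span
      ⟨(m, v), mem_coneLattice.2 ⟨hm, hg v (Finsupp.mem_support_iff.1 hv)⟩, rfl⟩
  exact h1 (AddMonoidAlgebra.mem_span_support_coeff g)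

theorem IsVertexWeight.expansion_one_eq_sum (hw : IsVertexWeight Δ b w ε)
    (hf : SuppIn f (dilation Δ 1)) (hfb : IsUnit (f.coeff b)) {g : Laurent R n}
    {S : Finset (Fin n → ℤ)} (hS : ∀ v, v ∈ S ↔ toReal v ∈ μ) (hg : SuppIn g (dilation μ 1)) :
    expansion f b g 1 = ∑ v : S, g.coeff v • omega f b (1, v) := by
  classical
  have h1 : g = ∑ v ∈ S, g.coeff v • (single v 1 : Laurent R n) := by
    ext k
    rw [AddMonoidAlgebra.coeff_sum, Finsupp.finsetSum_apply]
    simp only [AddMonoidAlgebra.coeff_smul_apply, AddMonoidAlgebra.coeff_single,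
      Finsupp.single_apply, smul_eq_mul, mul_ite, mul_one, mul_zero, Finset.sum_ite_eq']
    split_ifs with hk
    · rfl
    · exact hg.eq_zero fun h => hk ((hS k).2 (mem_dilation_one.1 h))
  have h2 := congrArg (hw.expansionLinear hf hfb 1) h1
  rw [map_sum] at h2
  simp only [map_smul] at h2
  rw [Finset.sum_coe_sort S fun v => g.coeff v • omega f b (1, v)]
  refine h2.trans (Finset.sum_congr rfl fun v _ => ?_)
  rw [omega, Nat.sub_self, Nat.factorial_zero, Nat.cast_one, one_smul]
  rfl

theorem IsVertexWeight.Omega_le (hw : IsVertexWeight Δ b w ε) (hf : SuppIn f (dilation Δ 1))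
    (hfb : IsUnit (f.coeff b)) (hμ : μ ⊆ Δ) : Omega f b μ ≤ OmegaFormal R Δ b := by
  rw [Omega, Submodule.span_le]
  rintro _ ⟨u, hu, rfl⟩
  exact Submodule.smul_mem _ _ (hw.expansion_mem_omegaFormal hf hfb
    (suppIn_single (dilation_mono hμ _ (mem_coneLattice.1 hu).2)))

end OmegaSpan

/-! ### The Cartier operator on rational functions, modulo p. -/

section Cartier

variable {R : Type*} [CommRing R] {n : ℕ} {Δ μ : Set (Fin n → ℝ)} {b : Fin n → ℤ}
  {w : (Fin n → ℤ) →+ ℝ} {ε : ℝ} {f f' : Laurent R n} {p : ℕ}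

/-- The Cartier operator applied to `A / f^{pM}`, with `f^p = f'(x^p) - p G`. -/
theorem IsVertexWeight.cartier_expansion (hw : IsVertexWeight Δ b w ε) (hp : p.Prime)
    (hf : SuppIn f (dilation Δ 1)) (hfb : IsUnit (f.coeff b))
    (hf' : SuppIn f' (dilation Δ 1)) (hfb' : IsUnit (f'.coeff b)) {G A : Laurent R n} {M : ℕ}
    (hA : SuppIn A (dilation Δ (p * M)))
    (hAG : ∀ r, SuppIn (cartierLaurent hp.ne_zero (A * G ^ r)) (dilation Δ (M + r)))
    (hG : expand p f' - f ^ p = p * G) (N : ℕ) (k : Fin n → ℤ) :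
    (p : R) ^ N ∣ (cartierLinear R n p (expansion f b A (p * M)) -
      ∑ r ∈ Finset.range N, ((p : R) ^ r * (Nat.multichoose M r : R)) •
        expansion f' b (cartierLaurent hp.ne_zero (A * G ^ r)) (M + r)) k := by
  set h₀ := expansion f b A (p * M) with hh₀
  have hact : act ((f ^ p) ^ M) h₀ = toSeries A := by
    rw [← pow_mul, hh₀, hw.act_pow_expansion hf hfb]
  refine hw.dvd_of_dvd_act_pow hf' hfb' (Submodule.sub_mem _ ?_ (Submodule.sum_mem _ fun r _ =>
    Submodule.smul_mem _ _ (hw.omegaFormal_le (hw.expansion_mem_omegaFormal hf' hfb' (hAG r)))))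
    (M + N) (fun k => ?_) k
  · exact hw.omegaFormal_le (cartierLinear_mem_omegaFormal hp.pos
      (hw.expansion_mem_omegaFormal hf hfb hA))
  · obtain ⟨Q, hQ⟩ := pow_dvd_pow_sub_sum_multichoose (expand p f') (p * G) M N
    have hT : expand p f' - p * G = f ^ p := by rw [← hG]; ring
    rw [hT] at hQ
    have hr : ∀ r ∈ Finset.range N, act (f' ^ (M + N))
        (expansion f' b (cartierLaurent hp.ne_zero (A * G ^ r)) (M + r)) =
        cartierLinear R n p (act (expand p f' ^ (N - r) * G ^ r * (f ^ p) ^ M) h₀) := by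
      intro r hr
      rw [show M + N = (N - r) + (M + r) by have := Finset.mem_range.1 hr; omega, pow_add,
        act_mul, hw.act_pow_expansion hf' hfb', toSeries_cartierLaurent]
      rw [act_cartier, map_pow, act_toSeries, act_mul, hact, act_toSeries]
      congr 2
      ring
    -- Multiplied by f'^{M+N}, the truncation error becomes C_p of a multiple of (pG)^N; dividing
    -- back by f' keeps the factor p^N.
    have hall : act (f' ^ (M + N)) (cartierLinear R n p h₀ -
        ∑ r ∈ Finset.range N, ((p : R) ^ r * (Nat.multichoose M r : R)) •
          expansion f' b (cartierLaurent hp.ne_zero (A * G ^ r)) (M + r)) =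
        cartierLinear R n p (act (((p : Laurent R n) * G) ^ N * Q) h₀) := by
      rw [← hQ, map_sub, map_sub, LinearMap.sub_apply, map_sub, act_cartier, map_pow, map_sum,
        Finset.sum_mul, map_sum, LinearMap.sum_apply, map_sum]
      congr 1
      refine Finset.sum_congr rfl fun r hr' => ?_
      rw [map_smul, hr r hr', ← map_smul]
      congr 1
      rw [← LinearMap.smul_apply, ← map_smul]
      congr 2
      rw [mul_pow, Algebra.smul_def, map_mul, map_pow, map_natCast, map_natCast]
      ring
    rw [hall, mul_pow, mul_assoc, act_mul, cartierLinear_apply,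
      show (p : Laurent R n) ^ N = algebraMap R _ ((p : R) ^ N) by rw [map_pow, map_natCast],
      AlgHom.commutes, Module.algebraMap_end_apply]
    exact dvd_mul_right _ _

variable [IsDomain R] [CharZero R]

theorem IsFrobeniusTwist.exists_remainder (hΔ : Convex ℝ Δ) (hne : Δ.Nonempty) (hp : p.Prime)
    (hf : SuppIn f (dilation Δ 1)) (hf' : SuppIn f' (dilation Δ 1))
    (h : IsFrobeniusTwist p f f') :
    ∃ G : Laurent R n, SuppIn G (dilation Δ p) ∧ expand p f' - f ^ p = p * G := by
  obtain ⟨G, hG⟩ := (isFrobeniusTwist_iff hp).1 h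
  refine ⟨G, ?_, hG⟩
  have h1 := hf.pow_dilation hΔ hne le_rfl p
  have h2 := suppIn_expand (p := p) hf'
  rw [mul_one] at h2
  rw [one_mul] at h1
  have h3 := h2.sub h1
  rw [hG, natCast_mul_eq_smul] at h3
  refine fun k hk => h3 k ?_
  rw [AddMonoidAlgebra.coeff_smul_apply, smul_eq_mul]
  exact mul_ne_zero (Nat.cast_ne_zero.2 hp.ne_zero) hk

/-- The terms r = 2i and r = 2i+1 both carry p^{i+1}; paired and divided by p they form a series in
powers p^i. -/
theorem mem_OmegaHat_of_half_series (hp : p ≠ 0) {W : ℕ → Series R n} (hW : ∀ r, W r ∈ Omega f b μ)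
    {h : Series R n} (hs : ∀ N k, (p : R) ^ N ∣ p * h k -
      ∑ r ∈ Finset.range N, (p : R) ^ (r / 2 + 1) * W r k) : h ∈ OmegaHat p f b μ := by
  refine mem_OmegaHat.2 ⟨fun i => W (2 * i) + W (2 * i + 1), fun i =>
    Submodule.add_mem _ (hW _) (hW _), fun s k => ?_⟩
  cases s with
  | zero => simp
  | succ s =>
    have hsum : ∀ s, ∑ r ∈ Finset.range (2 * s), (p : R) ^ (r / 2 + 1) * W r k =
        p * ∑ i ∈ Finset.range s, (p : R) ^ i * (W (2 * i) + W (2 * i + 1)) k := by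
      intro s
      induction s with
      | zero => simp
      | succ s ih =>
        rw [show 2 * (s + 1) = 2 * s + 1 + 1 by ring, Finset.sum_range_succ,
          Finset.sum_range_succ, ih, Finset.sum_range_succ, show 2 * s / 2 = s by omega,
          show (2 * s + 1) / 2 = s by omega, Pi.add_apply]
        ring
    have h1 := (pow_dvd_pow (p : R) (show s + 1 + 1 ≤ 2 * (s + 1) by omega)).trans
      (hs (2 * (s + 1)) k)
    rw [hsum, ← mul_sub, pow_succ'] at h1
    exact (mul_dvd_mul_iff_left (Nat.cast_ne_zero.2 hp)).1 h1

variable [IsAdicComplete (Ideal.span {(p : R)}) R]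

/-- The Cartier operator on `ω_u`, modulo `p`. -/
theorem IsVertexWeight.cartier_omega (hw : IsVertexWeight Δ b w ε) (hμ : IsFaceOpen Δ μ)
    (hp : p.Prime) (hp2 : 2 < p) (hf : SuppIn f (dilation Δ 1)) (hfb : IsUnit (f.coeff b))
    (hf' : SuppIn f' (dilation Δ 1)) (hfb' : IsUnit (f'.coeff b)) (h : IsFrobeniusTwist p f f')
    {M r : ℕ} (hM : 1 ≤ M) (hr : r < p) {v : Fin n → ℤ} (hv : v ∈ dilation μ (p * M - r)) :
    ∃ η ∈ OmegaHat p f' b μ, cartierLinear R n p (omega f b (p * M - r, v)) =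
      ((p * M - r - 1).factorial : R) • expansion f' b
        (cartierLaurent hp.ne_zero (single v 1 * f ^ r)) M + (p : R) • η := by
  obtain ⟨G, hGs, hG⟩ := h.exists_remainder hw.convex ⟨_, hw.mem⟩ hp hf hf'
  set A : Laurent R n := single v 1 * f ^ r with hAdef
  set m := p * M - r with hm
  have hpM' : p * M = p * (M - 1) + p := by rw [← Nat.mul_succ, Nat.succ_eq_add_one]; congr 1; omega
  have hm1 : 1 ≤ m := by omega
  have hAμ : SuppIn A (dilation μ (p * M)) := by
    have h1 := hf.pow_dilation hw.convex ⟨_, hw.mem⟩ le_rfl r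
    rw [one_mul] at h1
    have h2 := (suppIn_single (r := (1 : R)) hv).mul_dilation hμ hw.convex hm1 h1
    rwa [show m + r = p * M by omega] at h2
  have hpM : 1 ≤ p * M := by omega
  have hAG : ∀ j, SuppIn (cartierLaurent hp.ne_zero (A * G ^ j)) (dilation μ (M + j)) := by
    intro j k hk
    rw [coeff_cartierLaurent] at hk
    have h1 := hGs.pow_dilation hw.convex ⟨_, hw.mem⟩ hp.one_le j
    have h2 := hAμ.mul_dilation hμ hw.convex hpM h1
    rw [← mul_add] at h2
    exact dilation_of_nsmul hp.ne_zero (h2 _ hk)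
  -- Raising the pole order to a multiple of p, at the cost of f^r in the numerator, makes the
  -- Cartier expansion applicable.
  have hω : omega f b (m, v) = ((m - 1).factorial : R) • expansion f b A (p * M) := by
    have h1 := hw.expansion_mul_pow hf hfb
      (suppIn_single (r := (1 : R)) (dilation_mono hμ.1 _ hv)) hm1 r
    rw [show m + r = p * M by omega] at h1
    rw [omega, h1]
  obtain ⟨D, hD⟩ : (M - 1).factorial ∣ (m - 1).factorial := by
    refine Nat.factorial_dvd_factorial ?_
    have := Nat.le_mul_of_pos_left (M - 1) hp.pos
    omega
  have hc : ∀ j, ∃ c : R, 1 ≤ j → (p : R) ^ j * (Nat.multichoose M j : R) *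
      ((M - 1).factorial : R) = (p : R) ^ (j / 2 + 1) * c * ((M + j - 1).factorial : R) := by
    intro j
    by_cases hj : 1 ≤ j
    · obtain ⟨c, hc⟩ := exists_pow_mul_multichoose_eq (R := R) hp hp2 hM hj
      exact ⟨c, fun _ => hc⟩
    · exact ⟨0, fun h => absurd h hj⟩
  choose c hc using hc
  set E : ℕ → Series R n := fun j =>
    expansion f' b (cartierLaurent hp.ne_zero (A * G ^ j)) (M + j) with hE
  -- Index 0 is zeroed because that term is the main term subtracted in x; the bound by p^{j/2+1} is
  -- only available for j ≥ 1.
  set W : ℕ → Series R n := fun j =>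
    if j = 0 then 0 else ((D : R) * c j) • (((M + j - 1).factorial : R) • E j) with hWdef
  have hW : ∀ j, W j ∈ Omega f' b μ := by
    intro j
    simp only [hWdef]
    split_ifs
    · exact Submodule.zero_mem _
    · exact Submodule.smul_mem _ _
        (hw.smul_expansion_mem_Omega hf' hfb' (by omega) (hAG j))
  set x : Series R n := cartierLinear R n p (omega f b (m, v)) -
    ((m - 1).factorial : R) • expansion f' b (cartierLaurent hp.ne_zero A) M with hx
  have hx' : ∀ N k, (p : R) ^ N ∣ x k -
      ∑ j ∈ Finset.range N, (p : R) ^ (j / 2 + 1) * W j k := by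
    intro N k
    cases N with
    | zero => simp
    | succ N =>
      have h1 := hw.cartier_expansion hp hf hfb hf' hfb' (hAμ.mono (dilation_mono hμ.1 _))
        (fun j => (hAG j).mono (dilation_mono hμ.1 _)) hG (N + 1) k
      convert h1.mul_left ((m - 1).factorial : R) using 1
      rw [hx, hω, map_smul, Finset.sum_range_succ', Finset.sum_range_succ', Pi.sub_apply,
        Pi.sub_apply, Pi.add_apply, Finset.sum_apply, mul_sub, mul_add, Finset.mul_sum]
      have h2 : ∀ j, (p : R) ^ ((j + 1) / 2 + 1) * W (j + 1) k = ((m - 1).factorial : R) *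
          (((p : R) ^ (j + 1) * (Nat.multichoose M (j + 1) : R)) • E (j + 1)) k := by
        intro j
        simp only [hWdef, Nat.succ_ne_zero, if_false, Pi.smul_apply, smul_eq_mul, hD]
        push_cast
        linear_combination -(D : R) * E (j + 1) k * hc (j + 1) (by omega)
      rw [Finset.sum_congr rfl fun j _ => h2 j]
      simp [hWdef]
      ring
  have hdvd : ∀ k, (p : R) ∣ x k := fun k => by
    simpa [hWdef] using hx' 1 k
  choose η hη using hdvd
  refine ⟨η, mem_OmegaHat_of_half_series hp.ne_zero hW fun N k => ?_, ?_⟩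
  · rw [← hη]
    exact hx' N k
  · have h3 : x = (p : R) • η := funext hη
    rw [← h3, hx]
    abel

end Cartier

end

noncomputable section

open AddMonoidAlgebra

/-! ### Invertibility of the Hasse–Witt matrix under Frobenius twists. -/

section HasseWitt

variable {R : Type*} [CommRing R] {n : ℕ} {p : ℕ}

/-- The Hasse--Witt matrix of `f` relative to the set `S` of exponents. -/
def hasseWitt (p : ℕ) (S : Finset (Fin n → ℤ)) (f : Laurent R n) : Matrix S S R :=
  fun u v => (f ^ (p - 1)).coeff (p • (v : Fin n → ℤ) - (u : Fin n → ℤ))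

/-- Modulo p the p-th power map is a ring homomorphism, so entrywise p-th powers of an inverse of B
invert B' modulo p, and units lift from R/p. -/
theorem isUnit_of_dvd_sub_pow {S : Type*} [Fintype S] [DecidableEq S]
    [IsAdicComplete (Ideal.span {(p : R)}) R] (hp : p.Prime) {B B' : Matrix S S R}
    (h : ∀ u v, (p : R) ∣ B' u v - B u v ^ p) (hB : IsUnit B) : IsUnit B' := by
  obtain ⟨C, hC⟩ := hB.exists_right_inv
  set X : Matrix S S R := B' * C.map (· ^ p)
  have hX : ∀ u v, (p : R) ∣ X u v - (1 : Matrix S S R) u v := by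
    intro u v
    have h1 : (1 : Matrix S S R) u v = (1 : Matrix S S R) u v ^ p := by
      rw [Matrix.one_apply]
      split_ifs <;> simp [hp.ne_zero]
    have h2 := natCast_dvd_sum_pow_sub hp Finset.univ fun w => B u w * C w v
    have hXu : X u v = ∑ w, B' u w * C w v ^ p := Matrix.mul_apply
    rw [h1, ← hC, hXu, Matrix.mul_apply]
    have h3 : (p : R) ∣ ∑ w, (B' u w - B u w ^ p) * C w v ^ p :=
      Finset.dvd_sum fun w _ => (h u w).mul_right _
    convert dvd_sub h3 h2 using 1
    simp only [sub_mul, Finset.sum_sub_distrib, mul_pow]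
    ring
  have hdet : (p : R) ∣ X.det - 1 := by
    rw [← Ideal.mem_span_singleton, ← Ideal.Quotient.eq, RingHom.map_det, map_one]
    have : (Ideal.Quotient.mk (Ideal.span {(p : R)})).mapMatrix X = 1 := by
      ext u v
      rw [RingHom.mapMatrix_apply, Matrix.map_apply]
      have h4 := hX u v
      rw [← Ideal.mem_span_singleton, ← Ideal.Quotient.eq] at h4
      rw [h4, Matrix.one_apply, Matrix.one_apply]
      split_ifs <;> simp
    rw [this, Matrix.det_one]
  rw [Matrix.det_mul] at hdet
  exact (Matrix.isUnit_iff_isUnit_det _).2 (isUnit_of_isUnit_mod p hdet)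

/-- Laurent polynomials supported in `Δ` to which the decomposition theorem applies. -/
structure IsAdmissible (p : ℕ) (Δ : Set (Fin n → ℝ)) (b : Fin n → ℤ) (S : Finset (Fin n → ℤ))
    (f : Laurent R n) : Prop where
  supp : SuppIn f (dilation Δ 1)
  unit : IsUnit (f.coeff b)
  hasseWitt : IsUnit (hasseWitt p S f)

variable {Δ : Set (Fin n → ℝ)} {b : Fin n → ℤ} {S : Finset (Fin n → ℤ)} {f f' : Laurent R n}

theorem IsAdmissible.of_isFrobeniusTwist [IsAdicComplete (Ideal.span {(p : R)}) R]
    (hp : p.Prime) (h : IsAdmissible p Δ b S f) (hff' : IsFrobeniusTwist p f f')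
    (hf' : SuppIn f' (dilation Δ 1)) : IsAdmissible p Δ b S f' := by
  refine ⟨hf', ?_, isUnit_of_dvd_sub_pow hp (fun u v => hff'.pow hp (p - 1) _) h.hasseWitt⟩
  obtain ⟨y, hy⟩ := (h.unit.pow p).exists_right_inv
  refine isUnit_of_isUnit_mod p (y := y) ?_
  rw [← hy, ← sub_mul]
  exact (hff' b).mul_right _

theorem IsAdmissible.powTwist [IsAdicComplete (Ideal.span {(p : R)}) R]
    (hp : p.Prime) (h : IsAdmissible p Δ b S f) : IsAdmissible p Δ b S (powTwist hp.ne_zero f) :=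
  h.of_isFrobeniusTwist hp (isFrobeniusTwist_powTwist _ _) fun k hk => h.supp k fun h0 => hk (by
    rw [coeff_powTwist, h0, zero_pow hp.ne_zero])

end HasseWitt

/-! ### Decomposition of the completed module modulo formal derivatives. -/

section Decomposition

variable {R : Type*} [CommRing R] [IsDomain R] [CharZero R] {n : ℕ} {Δ μ : Set (Fin n → ℝ)}
  {b : Fin n → ℤ} {w : (Fin n → ℤ) →+ ℝ} {ε : ℝ} {S : Finset (Fin n → ℤ)} {f f' : Laurent R n}
  {p : ℕ}

/-- The linear combinations of the `ω_v`, `v ∈ S`. -/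
def omegaSum (f : Laurent R n) (b : Fin n → ℤ) (S : Finset (Fin n → ℤ)) :
    (S → R) →ₗ[R] Series R n :=
  Fintype.linearCombination R fun v : S => omega f b (1, (v : Fin n → ℤ))

omit [IsDomain R] [CharZero R] in
theorem omegaSum_apply (c : S → R) :
    omegaSum f b S c = ∑ v : S, c v • omega f b (1, (v : Fin n → ℤ)) :=
  Fintype.linearCombination_apply _ _ _

omit [IsDomain R] [CharZero R] in
theorem omega_mem_Omega (hS : ∀ v, v ∈ S ↔ toReal v ∈ μ) (v : S) :
    omega f b (1, (v : Fin n → ℤ)) ∈ Omega f b μ :=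
  Submodule.subset_span
    ⟨_, mem_coneLattice.2 ⟨le_rfl, mem_dilation_one.2 ((hS v).1 v.2)⟩, rfl⟩

omit [IsDomain R] [CharZero R] in
theorem omegaSum_mem_Omega (hS : ∀ v, v ∈ S ↔ toReal v ∈ μ) (c : S → R) :
    omegaSum f b S c ∈ Omega f b μ := by
  rw [omegaSum_apply]
  exact Submodule.sum_mem _ fun v _ => Submodule.smul_mem _ _ (omega_mem_Omega hS v)

omit [IsDomain R] [CharZero R] in
theorem IsVertexWeight.act_omega_one (hw : IsVertexWeight Δ b w ε)
    (hf : SuppIn f (dilation Δ 1)) (hfb : IsUnit (f.coeff b)) (v : Fin n → ℤ) :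
    act f (omega f b (1, v)) = toSeries (single v 1) := by
  have h := hw.act_pow_expansion hf hfb (single v 1) 1
  rw [pow_one] at h
  rw [← h, omega, Nat.sub_self, Nat.factorial_zero, Nat.cast_one, one_smul]

-- Multiplication by f turns the combination into the Laurent polynomial Σ c_v x^v, whose
-- coefficients are read off.
omit [IsDomain R] [CharZero R] in
theorem IsVertexWeight.dvd_of_dvd_omegaSum (hw : IsVertexWeight Δ b w ε)
    (hf : SuppIn f (dilation Δ 1)) (hfb : IsUnit (f.coeff b)) {d : R} {c : S → R}
    (h : ∀ k, d ∣ omegaSum f b S c k) (v : S) : d ∣ c v := by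
  classical
  choose x hx using h
  have h1 : omegaSum f b S c = d • x := funext hx
  have h2 := congrFun (congrArg (act f) h1) v
  rw [omegaSum_apply, map_sum, map_smul, Finset.sum_apply, Pi.smul_apply, smul_eq_mul] at h2
  have h3 : ∀ u : S, act f (c u • omega f b (1, (u : Fin n → ℤ))) (v : Fin n → ℤ) =
      if u = v then c u else 0 := by
    intro u
    rw [map_smul, hw.act_omega_one hf hfb, Pi.smul_apply, toSeries_apply, coeff_single,
      Finsupp.single_apply]
    by_cases huv : u = v
    · simp [huv]
    · simp [huv]
  rw [Finset.sum_congr rfl fun u _ => h3 u] at h2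
  simp only [Finset.sum_ite_eq', Finset.mem_univ, if_true] at h2
  exact ⟨_, h2⟩

omit [IsDomain R] [CharZero R] in
theorem IsVertexWeight.suppIn_cartierLaurent (hw : IsVertexWeight Δ b w ε)
    (hμ : IsFaceOpen Δ μ) (hp : p.Prime) (hf : SuppIn f (dilation Δ 1)) {M r : ℕ} (hM : 1 ≤ M)
    (hr : r < p) {v : Fin n → ℤ} (hv : v ∈ dilation μ (p * M - r)) :
    SuppIn (cartierLaurent hp.ne_zero (single v (1 : R) * f ^ r)) (dilation μ M) := by
  have hpM : p ≤ p * M := Nat.le_mul_of_pos_right p hM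
  intro k hk
  rw [coeff_cartierLaurent] at hk
  have h1 := hf.pow_dilation hw.convex ⟨_, hw.mem⟩ le_rfl r
  rw [one_mul] at h1
  have h2 := (suppIn_single (r := (1 : R)) hv).mul_dilation hμ hw.convex (by omega) h1
  rw [Nat.sub_add_cancel (by omega)] at h2
  exact dilation_of_nsmul hp.ne_zero (h2 _ hk)

variable [IsAdicComplete (Ideal.span {(p : R)}) R]

theorem IsVertexWeight.cartier_omega_one (hw : IsVertexWeight Δ b w ε) (hμ : IsFaceOpen Δ μ)
    (hS : ∀ v, v ∈ S ↔ toReal v ∈ μ) (hp : p.Prime) (hp2 : 2 < p)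
    (hf : IsAdmissible p Δ b S f) (hf' : IsAdmissible p Δ b S f') (h : IsFrobeniusTwist p f f')
    (u : S) : ∃ η ∈ OmegaHat p f' b μ, cartierLinear R n p (omega f b (1, (u : Fin n → ℤ))) =
      omegaSum f' b S (hasseWitt p S f u) + (p : R) • η := by
  have h1 : p * 1 - (p - 1) = 1 := by have := hp.pos; omega
  have hu : (u : Fin n → ℤ) ∈ dilation μ (p * 1 - (p - 1)) := by
    rw [h1]
    exact mem_dilation_one.2 ((hS u).1 u.2)
  have hlt : p - 1 < p := by have := hp.pos; omega
  obtain ⟨η, hη, he⟩ := hw.cartier_omega hμ hp hp2 hf.supp hf.unit hf'.supp hf'.unit h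
    le_rfl hlt hu
  refine ⟨η, hη, ?_⟩
  rw [h1] at he
  rw [he, Nat.sub_self, Nat.factorial_zero, Nat.cast_one, one_smul,
    hw.expansion_one_eq_sum hf'.supp hf'.unit hS
      (hw.suppIn_cartierLaurent hμ hp hf.supp le_rfl hlt hu), omegaSum_apply]
  congr 1
  refine Finset.sum_congr rfl fun v _ => ?_
  rw [coeff_cartierLaurent, coeff_single_mul', one_mul]
  rfl

theorem IsVertexWeight.cartier_omegaSum (hw : IsVertexWeight Δ b w ε) (hμ : IsFaceOpen Δ μ)
    (hS : ∀ v, v ∈ S ↔ toReal v ∈ μ) (hp : p.Prime) (hp2 : 2 < p)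
    (hf : IsAdmissible p Δ b S f) (hf' : IsAdmissible p Δ b S f') (h : IsFrobeniusTwist p f f')
    (c : S → R) : ∃ η ∈ OmegaHat p f' b μ, cartierLinear R n p (omegaSum f b S c) =
      omegaSum f' b S (Matrix.vecMul c (hasseWitt p S f)) + (p : R) • η := by
  choose η hη he using hw.cartier_omega_one hμ hS hp hp2 hf hf' h
  refine ⟨∑ u, c u • η u, Submodule.sum_mem _ fun u _ => Submodule.smul_mem _ _ (hη u), ?_⟩
  rw [omegaSum_apply, map_sum, Matrix.vecMul_eq_sum, map_sum, Finset.smul_sum,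
    ← Finset.sum_add_distrib]
  refine Finset.sum_congr rfl fun u _ => ?_
  rw [map_smul, he, map_smul, smul_add, smul_comm (c u)]

theorem IsVertexWeight.cartier_mem_of_mem_Omega (hw : IsVertexWeight Δ b w ε)
    (hμ : IsFaceOpen Δ μ) (hS : ∀ v, v ∈ S ↔ toReal v ∈ μ) (hp : p.Prime) (hp2 : 2 < p)
    (hf : IsAdmissible p Δ b S f) (hf' : IsAdmissible p Δ b S f') (h : IsFrobeniusTwist p f f')
    {x : Series R n} (hx : x ∈ Omega f b μ) : ∃ d : S → R, ∃ η ∈ OmegaHat p f' b μ,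
      cartierLinear R n p x = omegaSum f' b S d + (p : R) • η := by
  induction hx using Submodule.span_induction with
  | zero => exact ⟨0, 0, Submodule.zero_mem _, by simp⟩
  | add x y _ _ hx hy =>
    obtain ⟨d, η, hη, hd⟩ := hx
    obtain ⟨d', η', hη', hd'⟩ := hy
    exact ⟨d + d', η + η', Submodule.add_mem _ hη hη', by
      rw [map_add, hd, hd', map_add, smul_add]; abel⟩
  | smul a x _ hx =>
    obtain ⟨d, η, hη, hd⟩ := hx
    exact ⟨a • d, a • η, Submodule.smul_mem _ _ hη, by
      rw [map_smul, hd, map_smul, smul_add, smul_comm a]⟩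
  | mem x hx =>
    obtain ⟨⟨m, v⟩, hu, rfl⟩ := hx
    obtain ⟨hm, hv⟩ := mem_coneLattice.1 hu
    dsimp only at hm hv
    obtain ⟨M, r, hM, hr, rfl⟩ : ∃ M r, 1 ≤ M ∧ r < p ∧ m = p * M - r := by
      -- Here M = ⌈m/p⌉ and r = pM - m.
      refine ⟨(m - 1) / p + 1, p - 1 - (m - 1) % p, Nat.le_add_left _ _, by have := hp.pos; omega, ?_⟩
      have h1 := Nat.div_add_mod (m - 1) p
      have h2 := Nat.mod_lt (m - 1) hp.pos
      rw [mul_add]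
      omega
    obtain ⟨η, hη, he⟩ := hw.cartier_omega hμ hp hp2 hf.supp hf.unit hf'.supp hf'.unit h hM hr hv
    have hs := hw.suppIn_cartierLaurent hμ hp hf.supp hM hr hv
    rcases hM.eq_or_lt with rfl | hM2
    · rw [hw.expansion_one_eq_sum hf'.supp hf'.unit hS hs] at he
      refine ⟨((p * 1 - r - 1).factorial : R) • fun t : S =>
        (cartierLaurent hp.ne_zero (single v 1 * f ^ r)).coeff t, η, hη, ?_⟩
      rw [he, map_smul, omegaSum_apply]
    · have hpM : p * M = p * (M - 1) + p := by
        rw [← Nat.mul_succ, Nat.succ_eq_add_one]; congr 1; omega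
      -- For M ≥ 2 the factorial (m-1)! has an extra factor p over (M-1)!, so poles of higher order
      -- contribute nothing modulo p.
      obtain ⟨D, hD⟩ : p * (M - 1).factorial ∣ (p * M - r - 1).factorial :=
        (factorial_mul_dvd hp.pos (by omega)).trans (Nat.factorial_dvd_factorial (by omega))
      have hmem := hw.smul_expansion_mem_Omega hf'.supp hf'.unit hM hs
      refine ⟨0, (D : R) • (((M - 1).factorial : R) • expansion f' b
        (cartierLaurent hp.ne_zero (single v 1 * f ^ r)) M) + η,
        Submodule.add_mem _ (Submodule.smul_mem _ _ (Omega_le_OmegaHat hmem)) hη, ?_⟩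
      rw [he, hD, map_zero, zero_add, smul_add, smul_smul, smul_smul]
      push_cast
      congr 2
      ring

theorem IsVertexWeight.cartier_mem_OmegaHat (hw : IsVertexWeight Δ b w ε)
    (hμ : IsFaceOpen Δ μ) (hS : ∀ v, v ∈ S ↔ toReal v ∈ μ) (hp : p.Prime) (hp2 : 2 < p)
    (hf : IsAdmissible p Δ b S f) (hf' : IsAdmissible p Δ b S f') (h : IsFrobeniusTwist p f f')
    {x : Series R n} (hx : x ∈ OmegaHat p f b μ) :
    cartierLinear R n p x ∈ OmegaHat p f' b μ := by
  obtain ⟨g, hg, hs⟩ := mem_OmegaHat.1 hx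
  refine mem_OmegaHat_of_series (e := fun i => cartierLinear R n p (g i)) (fun i => ?_)
    fun s k => hs s (p • k)
  obtain ⟨d, η, hη, hd⟩ := hw.cartier_mem_of_mem_Omega hμ hS hp hp2 hf hf' h (hg i)
  rw [hd]
  exact Submodule.add_mem _ (Omega_le_OmegaHat (omegaSum_mem_Omega hS d))
    (Submodule.smul_mem _ _ hη)

theorem IsVertexWeight.exists_cartier_eq (hw : IsVertexWeight Δ b w ε)
    (hμ : IsFaceOpen Δ μ) (hS : ∀ v, v ∈ S ↔ toReal v ∈ μ) (hp : p.Prime) (hp2 : 2 < p)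
    (hf : IsAdmissible p Δ b S f) (hf' : IsAdmissible p Δ b S f') (h : IsFrobeniusTwist p f f')
    {x : Series R n} (hx : x ∈ OmegaHat p f b μ) : ∃ d : S → R, ∃ η ∈ OmegaHat p f' b μ,
      cartierLinear R n p x = omegaSum f' b S d + (p : R) • η := by
  obtain ⟨g, hg, y, hy, rfl⟩ := exists_eq_add_smul_of_mem_OmegaHat hp.ne_zero hx
  obtain ⟨d, η, hη, hd⟩ := hw.cartier_mem_of_mem_Omega hμ hS hp hp2 hf hf' h hg
  refine ⟨d, η + cartierLinear R n p y, Submodule.add_mem _ hη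
    (hw.cartier_mem_OmegaHat hμ hS hp hp2 hf hf' h hy), ?_⟩
  rw [map_add, hd, map_smul, smul_add, add_assoc]

section Chain

variable {F : ℕ → Laurent R n}

/-- B is the product of the Hasse–Witt matrices of F 0, …, F (s-1). -/
theorem IsVertexWeight.exists_cartier_pow_omegaSum (hw : IsVertexWeight Δ b w ε)
    (hμ : IsFaceOpen Δ μ) (hS : ∀ v, v ∈ S ↔ toReal v ∈ μ) (hp : p.Prime) (hp2 : 2 < p)
    (hF : ∀ i, IsAdmissible p Δ b S (F i)) (hFF : ∀ i, IsFrobeniusTwist p (F i) (F (i + 1)))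
    (s : ℕ) : ∃ B : Matrix S S R, IsUnit B ∧ ∀ c : S → R, ∃ η ∈ OmegaHat p (F s) b μ,
      (cartierLinear R n p ^ s) (omegaSum (F 0) b S c) =
        omegaSum (F s) b S (Matrix.vecMul c B) + (p : R) • η := by
  induction s with
  | zero => exact ⟨1, isUnit_one, fun c => ⟨0, Submodule.zero_mem _, by simp⟩⟩
  | succ s ih =>
    obtain ⟨B, hB, h⟩ := ih
    refine ⟨B * hasseWitt p S (F s), hB.mul (hF s).hasseWitt, fun c => ?_⟩
    obtain ⟨η, hη, he⟩ := h c
    obtain ⟨η', hη', he'⟩ := hw.cartier_omegaSum hμ hS hp hp2 (hF s) (hF (s + 1)) (hFF s)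
      (Matrix.vecMul c B)
    refine ⟨η' + cartierLinear R n p η, Submodule.add_mem _ hη'
      (hw.cartier_mem_OmegaHat hμ hS hp hp2 (hF s) (hF (s + 1)) (hFF s) hη), ?_⟩
    rw [pow_succ', Module.End.mul_apply, he, map_add, he', Matrix.vecMul_vecMul, map_smul,
      smul_add, add_assoc]

/-- One p-adic digit: C_p^{s+1} x is p^s times a combination with coefficients d modulo p^{s+1}, and
e solves e B = d with B invertible. -/
theorem IsVertexWeight.exists_correction (hw : IsVertexWeight Δ b w ε)
    (hμ : IsFaceOpen Δ μ) (hS : ∀ v, v ∈ S ↔ toReal v ∈ μ) (hp : p.Prime) (hp2 : 2 < p)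
    (hF : ∀ i, IsAdmissible p Δ b S (F i)) (hFF : ∀ i, IsFrobeniusTwist p (F i) (F (i + 1)))
    {s : ℕ} {x : Series R n} (hx : ∃ η ∈ OmegaHat p (F s) b μ,
      (cartierLinear R n p ^ s) x = (p : R) ^ s • η) :
    ∃ e : S → R, ∃ η ∈ OmegaHat p (F (s + 1)) b μ, (cartierLinear R n p ^ (s + 1))
      (x - omegaSum (F 0) b S ((p : R) ^ s • e)) = (p : R) ^ (s + 1) • η := by
  obtain ⟨η, hη, he⟩ := hx
  obtain ⟨d, η₁, hη₁, hd⟩ := hw.exists_cartier_eq hμ hS hp hp2 (hF s) (hF (s + 1)) (hFF s) hη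
  obtain ⟨B, hB, h⟩ := hw.exists_cartier_pow_omegaSum hμ hS hp hp2 hF hFF (s + 1)
  obtain ⟨C, hC⟩ := hB.exists_left_inv
  obtain ⟨η₂, hη₂, h₂⟩ := h (Matrix.vecMul d C)
  refine ⟨Matrix.vecMul d C, η₁ - η₂, Submodule.sub_mem _ hη₁ hη₂, ?_⟩
  rw [Matrix.vecMul_vecMul, hC, Matrix.vecMul_one] at h₂
  rw [map_sub, map_smul, map_smul, h₂, pow_succ', Module.End.mul_apply, he, map_smul, hd,
    ← smul_sub, add_sub_add_left_eq_sub, ← smul_sub, smul_smul, ← pow_succ]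

omit [IsDomain R] [CharZero R] [IsAdicComplete (Ideal.span {(p : R)}) R] in
theorem cartierLinear_pow_apply (s : ℕ) (h : Series R n) (k : Fin n → ℤ) :
    (cartierLinear R n p ^ s) h k = h (p ^ s • k) := by
  induction s generalizing h with
  | zero => simp
  | succ s ih =>
    rw [pow_succ, Module.End.mul_apply, ih, cartierLinear_apply, smul_smul, pow_succ']

theorem IsVertexWeight.exists_decomposition_chain (hw : IsVertexWeight Δ b w ε)
    (hμ : IsFaceOpen Δ μ) (hS : ∀ v, v ∈ S ↔ toReal v ∈ μ) (hp : p.Prime) (hp2 : 2 < p)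
    (hF : ∀ i, IsAdmissible p Δ b S (F i)) (hFF : ∀ i, IsFrobeniusTwist p (F i) (F (i + 1)))
    {x : Series R n} (hx : x ∈ OmegaHat p (F 0) b μ) :
    ∃ c : S → R, x - omegaSum (F 0) b S c ∈ formalExact p Δ (F 0) b μ := by
  let P : ℕ → (S → R) → Prop := fun s c => ∃ η ∈ OmegaHat p (F s) b μ,
    (cartierLinear R n p ^ s) (x - omegaSum (F 0) b S c) = (p : R) ^ s • η
  have hstep : ∀ s (c : {c // P s c}), ∃ c' : {c' // P (s + 1) c'}, ∃ e : S → R,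
      c'.1 = c.1 + (p : R) ^ s • e := by
    rintro s ⟨c, hc⟩
    obtain ⟨e, η, hη, he⟩ := hw.exists_correction hμ hS hp hp2 hF hFF hc
    exact ⟨⟨c + (p : R) ^ s • e, η, hη, by rw [map_add, ← sub_sub]; exact he⟩, e, rfl⟩
  choose next e hnext using hstep
  -- Successive corrections change c only by multiples of p^s, so the sequence converges p-adically.
  let seq : ∀ s, {c // P s c} := fun s =>
    Nat.rec (motive := fun s => {c // P s c}) ⟨0, x, hx, by simp⟩ (fun s c => next s c) s
  have hseq : ∀ s, (seq (s + 1)).1 = (seq s).1 + (p : R) ^ s • e s (seq s) := fun s =>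
    hnext s (seq s)
  have hlim : ∀ v : S, ∃ L : R, ∀ s, (p : R) ^ s ∣ L - (seq s).1 v := fun v =>
    exists_limit p (fun s => (seq s).1 v) fun s => ⟨e s (seq s) v, by
      rw [hseq]
      simp⟩
  choose c hc using hlim
  have hmem : x - omegaSum (F 0) b S c ∈ OmegaHat p (F 0) b μ :=
    Submodule.sub_mem _ hx (Omega_le_OmegaHat (omegaSum_mem_Omega hS c))
  refine ⟨c, hmem, mem_dOmegaFormal hp (OmegaHat_le_of_Omega_le
    (hw.Omega_le (hF 0).supp (hF 0).unit hμ.1) hmem) fun s k => ?_⟩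
  have hc' : ∃ r : S → R, c = (seq s).1 + (p : R) ^ s • r := by
    choose r hr using fun v => hc v s
    refine ⟨r, funext fun v => ?_⟩
    rw [Pi.add_apply, Pi.smul_apply, smul_eq_mul, ← hr]
    ring
  obtain ⟨r, hr⟩ := hc'
  obtain ⟨η, -, hη⟩ := (seq s).2
  have h1 := congrFun hη k
  rw [cartierLinear_pow_apply] at h1
  rw [hr, map_add, map_smul, ← sub_sub, Pi.sub_apply, h1]
  exact dvd_sub (dvd_mul_right _ _) (dvd_mul_right _ _)

/-- If c = p^s e, exactness gives p^{s+1} at exponents p^{s+1} k, so p divides the combination with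
coefficients e B; as B is invertible, p divides e. Hence c is infinitely divisible by p. -/
theorem IsVertexWeight.eq_zero_of_omegaSum_chain (hw : IsVertexWeight Δ b w ε)
    (hμ : IsFaceOpen Δ μ) (hS : ∀ v, v ∈ S ↔ toReal v ∈ μ) (hp : p.Prime) (hp2 : 2 < p)
    (hF : ∀ i, IsAdmissible p Δ b S (F i)) (hFF : ∀ i, IsFrobeniusTwist p (F i) (F (i + 1)))
    {c : S → R} (hc : omegaSum (F 0) b S c ∈ dOmegaFormal R Δ b) : c = 0 := by
  have key : ∀ s : ℕ, ∃ e : S → R, c = (p : R) ^ s • e := by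
    intro s
    induction s with
    | zero => exact ⟨c, by simp⟩
    | succ s ih =>
      obtain ⟨e, rfl⟩ := ih
      obtain ⟨B, hB, h⟩ := hw.exists_cartier_pow_omegaSum hμ hS hp hp2 hF hFF (s + 1)
      obtain ⟨C, hC⟩ := hB.exists_right_inv
      obtain ⟨η, -, he⟩ := h e
      have hd : ∀ v, (p : R) ∣ Matrix.vecMul e B v := by
        refine hw.dvd_of_dvd_omegaSum (hF (s + 1)).supp (hF (s + 1)).unit fun k => ?_
        have h1 := pow_dvd_of_mem_dOmegaFormal (p := p) hc (s + 1) k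
        rw [map_smul, Pi.smul_apply, smul_eq_mul, pow_succ, mul_dvd_mul_iff_left
          (pow_ne_zero _ (Nat.cast_ne_zero.2 hp.ne_zero)), ← cartierLinear_pow_apply (s + 1) (omegaSum (F 0) b S e),
          he] at h1
        exact (dvd_add_left (dvd_mul_right _ _)).1 h1
      choose d hd using hd
      refine ⟨Matrix.vecMul d C, ?_⟩
      have h2 : Matrix.vecMul e B = (p : R) • d := funext hd
      have h3 := congrArg (fun x => Matrix.vecMul x C) h2
      simp only [Matrix.vecMul_vecMul, hC, Matrix.vecMul_one, Matrix.smul_vecMul] at h3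
      rw [h3, smul_smul, ← pow_succ]
  ext v
  refine eq_zero_of_forall_pow_dvd p fun s => ?_
  obtain ⟨e, he⟩ := key s
  exact ⟨e v, congrFun he v⟩

end Chain

theorem IsVertexWeight.exists_decomposition (hw : IsVertexWeight Δ b w ε)
    (hμ : IsFaceOpen Δ μ) (hS : ∀ v, v ∈ S ↔ toReal v ∈ μ) (hp : p.Prime) (hp2 : 2 < p)
    (hf : IsAdmissible p Δ b S f) {x : Series R n} (hx : x ∈ OmegaHat p f b μ) :
    ∃ c : S → R, x - omegaSum f b S c ∈ formalExact p Δ f b μ := by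
  refine hw.exists_decomposition_chain (F := fun i => (powTwist hp.ne_zero)^[i] f)
    hμ hS hp hp2 (fun i => ?_) (fun i => ?_) hx
  · induction i with
    | zero => exact hf
    | succ i ih => rw [Function.iterate_succ_apply']; exact ih.powTwist hp
  · rw [Function.iterate_succ_apply']
    exact isFrobeniusTwist_powTwist _ _

theorem IsVertexWeight.eq_zero_of_omegaSum_mem (hw : IsVertexWeight Δ b w ε)
    (hμ : IsFaceOpen Δ μ) (hS : ∀ v, v ∈ S ↔ toReal v ∈ μ) (hp : p.Prime) (hp2 : 2 < p)
    (hf : IsAdmissible p Δ b S f) {c : S → R}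
    (hc : omegaSum f b S c ∈ dOmegaFormal R Δ b) : c = 0 := by
  refine hw.eq_zero_of_omegaSum_chain (F := fun i => (UnitRoot.powTwist hp.ne_zero)^[i] f)
    hμ hS hp hp2 (fun i => ?_) (fun i => ?_) hc
  · induction i with
    | zero => exact hf
    | succ i ih => rw [Function.iterate_succ_apply']; exact ih.powTwist hp
  · rw [Function.iterate_succ_apply']
    exact isFrobeniusTwist_powTwist _ _

end Decomposition

end

/-! ### Twists and derivations of the ω_u, and the main theorem. -/

noncomputable section

open AddMonoidAlgebra

variable {R : Type*} [CommRing R] {n : ℕ} {Δ μ : Set (Fin n → ℝ)} {b : Fin n → ℤ}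
  {w : (Fin n → ℤ) →+ ℝ} {ε : ℝ} {f : Laurent R n}

theorem omega_one_mem_omegaFormal (hw : IsVertexWeight Δ b w ε) (hf : SuppIn f (dilation Δ 1))
    (hfb : IsUnit (f.coeff b)) {v : Fin n → ℤ} (hv : toReal v ∈ Δ) :
    omega f b (1, v) ∈ OmegaFormal R Δ b :=
  Submodule.smul_mem _ _ (hw.expansion_mem_omegaFormal hf hfb
    (suppIn_single (mem_dilation_one.2 hv)))

/-- Expansion commutes with the action of a ring endomorphism on coefficients. -/
theorem omega_one_twist (hw : IsVertexWeight Δ b w ε) (σ : R →+* R)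
    (hf : SuppIn f (dilation Δ 1)) (hfb : IsUnit (f.coeff b))
    (hf' : SuppIn (twist σ f) (dilation Δ 1)) (hfb' : IsUnit ((twist σ f).coeff b))
    {v : Fin n → ℤ} (hv : toReal v ∈ Δ) (k : Fin n → ℤ) :
    omega (twist σ f) b (1, v) k = σ (omega f b (1, v) k) := by
  classical
  have h : omega (twist σ f) b (1, v) = fun k => σ (omega f b (1, v) k) := by
    refine hw.eq_of_act_pow_eq hf' hfb' (hw.omegaFormal_le (omega_one_mem_omegaFormal hw hf' hfb' hv))
      (hw.omegaFormal_le fun k hk => ?_) 1 ?_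
    · rw [omega_one_mem_omegaFormal hw hf hfb hv k hk, map_zero]
    · rw [pow_one, hw.act_omega_one hf' hfb', act_twist, hw.act_omega_one hf hfb]
      ext k
      rw [toSeries_apply, coeff_single, Finsupp.single_apply]
      split_ifs <;> simp
  exact congrFun h k

theorem derivSeries_omega_one_mem (hw : IsVertexWeight Δ b w ε) (hμ : IsFaceOpen Δ μ)
    (δ : Derivation ℤ R R) (hf : SuppIn f (dilation Δ 1)) (hfb : IsUnit (f.coeff b))
    {v : Fin n → ℤ} (hv : toReal v ∈ μ) : derivSeries δ (omega f b (1, v)) ∈ Omega f b μ := by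
  classical
  set δf : Laurent R n := AddMonoidAlgebra.map (δ : R →+ R) f
  have hδf : SuppIn δf (dilation Δ 1) := fun k hk => hf k fun h0 => hk (by
    change δ (f.coeff k) = 0
    rw [h0, map_zero])
  have hg : SuppIn (single v (1 : R) * δf) (dilation μ 2) :=
    (suppIn_single (mem_dilation_one.2 hv)).mul_dilation hμ hw.convex le_rfl hδf
  have hΔ := hμ.1 hv
  -- Obtained by applying δ to f ω = x^v. The pole order is 2 and (2-1)! = 1, so no factorial is
  -- missing.
  have h : derivSeries δ (omega f b (1, v)) = -expansion f b (single v 1 * δf) 2 := by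
    refine hw.eq_of_act_pow_eq hf hfb (hw.omegaFormal_le fun k hk => ?_)
      (Submodule.neg_mem _ (hw.omegaFormal_le
        (hw.expansion_mem_omegaFormal hf hfb (hg.mono (dilation_mono hμ.1 2))))) 2 ?_
    · rw [derivSeries, omega_one_mem_omegaFormal hw hf hfb hΔ k hk, map_zero]
    · have h1 := derivSeries_act δ f (omega f b (1, v))
      have h2 : derivSeries δ (toSeries (single v 1 : Laurent R n)) = 0 := by
        ext k
        rw [derivSeries, toSeries_apply, coeff_single, Finsupp.single_apply]
        split_ifs <;> simp
      rw [hw.act_omega_one hf hfb, h2] at h1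
      rw [map_neg, hw.act_pow_expansion hf hfb, pow_two, act_mul,
        eq_neg_of_add_eq_zero_left h1.symm, map_neg, ← act_mul, mul_comm, act_mul,
        hw.act_omega_one hf hfb, act_toSeries, mul_comm]
  have h3 := hw.smul_expansion_mem_Omega hf hfb (m := 2) (by norm_num) hg
  rw [h]
  refine Submodule.neg_mem _ ?_
  simpa using h3

theorem mem_latticePoints (hμ : μ ⊆ newtonPolytope f) (v : Fin n → ℤ) :
    v ∈ latticePoints f μ ↔ toReal v ∈ μ := by
  classical
  rw [latticePoints, Finset.mem_filter, Set.Finite.mem_toFinset, Set.mem_ofPred_eq]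
  exact ⟨fun h => h.2, fun h => ⟨hμ h, h⟩⟩

end

end UnitRoot

theorem theorem5p7 {R : Type*} [CommRing R] [IsDomain R] [CharZero R]
    (p : ℕ) (hp : p.Prime) (hp2 : 2 < p) [IsAdicComplete (Ideal.span {(p : R)}) R]
    (n : ℕ) (f : Laurent R n)
    (b : Fin n → ℤ) (hb : toReal b ∈ (newtonPolytope f).extremePoints ℝ)
    (hfb : IsUnit (f.coeff b))
    (μ : Set (Fin n → ℝ)) (hμ : IsFaceOpen (newtonPolytope f) μ)
    (hβ : IsUnit (beta f μ p)) :
    (∀ σ : R →+* R, IsFrobeniusLift p σ →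
      ∃ Λ : Matrix (latticePoints f μ) (latticePoints f μ) R,
        IsCartierMatrix p f b μ σ Λ ∧
        (∀ Λ', IsCartierMatrix p f b μ σ Λ' → Λ' = Λ) ∧
        ∀ k : Fin n → ℤ, toReal k ∈ vertexCone (newtonPolytope f) b →
          ∀ s : ℕ, 1 ≤ s → ∀ u : latticePoints f μ,
            (p : R) ^ s ∣ coeffVector f b μ (p ^ s • k) u -
              Λ.mulVec (fun w => σ (coeffVector f b μ (p ^ (s - 1) • k) w)) u) ∧
    (∀ δ : Derivation ℤ R R,
      ∃ N : Matrix (latticePoints f μ) (latticePoints f μ) R,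
        IsConnectionMatrix p f b μ δ N ∧
        (∀ N', IsConnectionMatrix p f b μ δ N' → N' = N) ∧
        ∀ k : Fin n → ℤ, toReal k ∈ vertexCone (newtonPolytope f) b →
          ∀ s : ℕ, 1 ≤ s → ∀ u : latticePoints f μ,
            (p : R) ^ s ∣ δ (coeffVector f b μ (p ^ s • k) u) -
              N.mulVec (coeffVector f b μ (p ^ s • k)) u) := by
  obtain ⟨w, ε, hw⟩ := exists_isVertexWeight f hb
  set S := latticePoints f μ
  have hS : ∀ v, v ∈ S ↔ toReal v ∈ μ := mem_latticePoints hμ.1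
  have hf : IsAdmissible p (newtonPolytope f) b S f := ⟨suppIn_newtonPolytope f, hfb, hβ⟩
  have huniq : ∀ {g : Laurent R n}, IsAdmissible p (newtonPolytope f) b S g →
      ∀ {x : Series R n} {c c' : S → R},
      x - omegaSum g b S c ∈ formalExact p (newtonPolytope f) g b μ →
      x - omegaSum g b S c' ∈ formalExact p (newtonPolytope f) g b μ → c' = c := by
    intro g hg x c c' h h'
    have h1 := (Submodule.sub_mem _ h h').2
    rw [sub_sub_sub_cancel_left, ← map_sub] at h1
    exact sub_eq_zero.1 (hw.eq_zero_of_omegaSum_mem hμ hS hp hp2 hg h1)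
  constructor
  · intro σ hσ
    have hff' := isFrobeniusTwist_twist hσ f
    have hf' : IsAdmissible p (newtonPolytope f) b S (twist σ f) :=
      hf.of_isFrobeniusTwist hp hff' fun k hk => hf.supp k fun h0 => hk (by
        rw [twist, AddMonoidAlgebra.coeff_mapRingHom, h0, map_zero])
    -- Decomposing η rather than C_p(ω_u) keeps the error as p times a formal derivative. At p^s k
    -- this gives p^{s+1}, one power more than a formal derivative alone.
    have hex : ∀ u : S, ∃ c : S → R, ∃ y ∈ formalExact p (newtonPolytope f) (twist σ f) b μ,
        cartierLinear R n p (omega f b (1, (u : Fin n → ℤ))) - omegaSum (twist σ f) b S c =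
          (p : R) • y := by
      intro u
      obtain ⟨η, hη, he⟩ := hw.cartier_omega_one hμ hS hp hp2 hf hf' hff' u
      obtain ⟨c, hc⟩ := hw.exists_decomposition hμ hS hp hp2 hf' hη
      refine ⟨hasseWitt p S f u + (p : R) • c, _, hc, ?_⟩
      rw [he, map_add, map_smul, smul_sub]
      abel
    choose Λ y hy hΛ using hex
    have hmem : ∀ u : S, cartierLinear R n p (omega f b (1, (u : Fin n → ℤ))) -
        omegaSum (twist σ f) b S (Λ u) ∈ formalExact p (newtonPolytope f) (twist σ f) b μ :=
      fun u => by rw [hΛ]; exact Submodule.smul_mem _ _ (hy u)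
    refine ⟨Λ, fun u => ?_, fun Λ' hΛ' => ?_, fun k _ s hs u => ?_⟩
    · have := hmem u
      rwa [omegaSum_apply] at this
    · refine funext fun u => huniq hf' (hmem u) ?_
      rw [omegaSum_apply]
      exact hΛ' u
    · obtain ⟨s, rfl⟩ := Nat.exists_eq_add_of_le' hs
      have h1 := congrFun (hΛ u) (p ^ s • k)
      rw [Pi.sub_apply, cartierLinear_apply, smul_smul, ← pow_succ', omegaSum_apply,
        Finset.sum_apply, Pi.smul_apply, smul_eq_mul] at h1
      have h2 : ∀ v : S, (Λ u v • omega (twist σ f) b (1, (v : Fin n → ℤ))) (p ^ s • k) =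
          Λ u v * σ (coeffVector f b μ (p ^ s • k) v) := fun v => by
        rw [Pi.smul_apply, smul_eq_mul, omega_one_twist hw σ hf.supp hf.unit hf'.supp hf'.unit
          (hμ.1 ((hS v).1 v.2))]
        rfl
      rw [Finset.sum_congr rfl fun v _ => h2 v] at h1
      rw [Nat.add_sub_cancel]
      change _ ∣ omega f b (1, (u : Fin n → ℤ)) (p ^ (s + 1) • k) -
        ∑ v, Λ u v * σ (coeffVector f b μ (p ^ s • k) v)
      rw [h1, pow_succ']
      exact mul_dvd_mul_left _ (pow_dvd_of_mem_dOmegaFormal (hy u).2 s k)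
  · intro δ
    have hex : ∀ u : S, ∃ c : S → R, derivSeries δ (omega f b (1, (u : Fin n → ℤ))) -
        omegaSum f b S c ∈ formalExact p (newtonPolytope f) f b μ := fun u =>
      hw.exists_decomposition hμ hS hp hp2 hf (Omega_le_OmegaHat
        (derivSeries_omega_one_mem hw hμ δ hf.supp hf.unit ((hS u).1 u.2)))
    choose N hN using hex
    refine ⟨N, fun u => ?_, fun N' hN' => ?_, fun k _ s _ u => ?_⟩
    · have := hN u
      rwa [omegaSum_apply] at this
    · refine funext fun u => huniq hf (hN u) ?_
      rw [omegaSum_apply]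
      exact hN' u
    · have h1 := pow_dvd_of_mem_dOmegaFormal (p := p) (hN u).2 s k
      rw [Pi.sub_apply, omegaSum_apply, Finset.sum_apply] at h1
      exact h1
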